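/- For $n\ge 0$ let $\Gamma(n)$ be the semigroup of partial bijections of $\{1,\dots,n\}$ (equivalently, of $n\times n$ $(0,1)$-matrices with at most one $1$ in each row and column, with matrix multiplication), and let $A(n)=\mathbb{C}[\Gamma(n)]$ be its semigroup algebra. Let $\varepsilon_i\in\Gamma(n)$ be the identity map of $\{1,\dots,n\}\setminus\{i\}$, and let $\theta_n:A(n)\to A(n-1)$ be the linear map that strikes out the last row and column of each $\gamma\in\Gamma(n)$. The degree of $\gamma\in\Gamma(n)$ is the number of $i$ with $\gamma_{ii}=0$, and the degree of $a\in A(n)$ is the maximal degree of the $\gamma$ occurring in $a$ (the zero element satisfies every degree bound). For $0\le m\le n$ let $\Gamma_m(n)\subseteq\Gamma(n)$ consist of the $\gamma$ with $\gamma_{11}=\dots=\gamma_{mm}=1$, and let $A_m(n)$ be the centralizer of $\Gamma_m(n)$ in $A(n)$. Let $A_m$ be the algebra, with componentwise operations, of all sequences $a=(a_n)_{n\ge m}$ such that $$a_n\in A_m(n)\ (n\ge m),\qquad \theta_n(a_n)=a_{n-1}\ (n>m),\qquad \sup_{n\ge m}\deg a_n<\infty .$$ The algebra $A(m)$ embeds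 in $A_m$ as constant sequences, where $A(m)\subseteq A(n)$ by letting $\gamma\in\Gamma(m)$ fix $m+1,\dots,n$. For $1\le k\le m$ let $u_k\in A_m$ be the sequence of the elements $u_{k|n}=\sum_{i=k+1}^n (k\,i)(1-\varepsilon_k)(1-\varepsilon_i)$. Let $\widetilde{\mathcal H}_m$ be the subalgebra of $A_m$ generated by $A(m)$ and $u_1,\dots,u_m$, and write $s_k=(k,k+1)\in A(m)$ for $1\le k\le m-1$. Let $\mathcal H_m$ be the degenerate affine Hecke algebra: the unital associative $\mathbb{C}$-algebra generated by $s_1,\dots,s_{m-1},u_1,\dots,u_m$ with the defining relations $$s_k^2=1,\qquad s_ks_{k+1}s_k=s_{k+1}s_ks_{k+1},\qquad s_ks_l=s_ls_k\ (|k-l|>1),$$ $$s_ku_k=u_{k+1}s_k+1,\qquad s_ku_l=u_ls_k\ (l\ne k,k+1),\qquad u_ku_l=u_lu_k .$$ **Claim.** For every $m\ge 0$ there is exactly one homomorphism of unital $\mathbb{C}$-algebras $\widetilde{\mathcal H}_m\to\mathcal H_m$ with $$s_k\mapsto s_k\ (1\le k\le m-1),\qquad u_k\mapsto u_k,\quad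 \varepsilon_k\mapsto 0\ (1\le k\le m),$$ and this homomorphism is surjective. -/

import Mathlib

noncomputable section

namespace SemigroupHecke

/-! ### The semigroup of partial bijections -/

/-- The partial bijections of an `n`-element set; the points `1, …, n` are labelled `0, …, n - 1`.
`γ x = some y` means that `γ` is defined at `x` and sends it to `y`. -/
abbrev PBij (n : ℕ) : Type := Fin n ≃. Fin n

/-- The product `γ₁ γ₂` is the partial map `x ↦ γ₁ (γ₂ x)`. The zero of the semigroup is an ordinary
element, so it is not identified with the zero of the semigroup algebra below. -/
instance instMonoidPBij (n : ℕ) : Monoid (PBij n) where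
  mul f g := PEquiv.trans g f
  one := PEquiv.refl _
  mul_assoc f g h := (PEquiv.trans_assoc h g f).symm
  one_mul f := PEquiv.trans_refl f
  mul_one f := PEquiv.refl_trans f

theorem mul_def {n : ℕ} (f g : PBij n) : f * g = PEquiv.trans g f := rfl

theorem one_def {n : ℕ} : (1 : PBij n) = PEquiv.refl (Fin n) := rfl

theorem mul_apply {n : ℕ} (f g : PBij n) (x : Fin n) : (f * g) x = (g x).bind f := rfl

theorem one_apply {n : ℕ} (x : Fin n) : (1 : PBij n) x = some x := rfl

/-- The transposition `(a b)`. -/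
def swapP {n : ℕ} (a b : Fin n) : PBij n := (Equiv.swap a b).toPEquiv

/-- The idempotent `ε_i`: the identity of the complement of `{i}`. -/
def epsP {n : ℕ} (i : Fin n) : PBij n := PEquiv.ofSet {i}ᶜ

theorem swapP_apply {n : ℕ} (a b x : Fin n) : swapP a b x = some (Equiv.swap a b x) := rfl

theorem epsP_apply {n : ℕ} (i x : Fin n) : epsP i x = if x = i then none else some x := by
  change (if x ∈ ({i}ᶜ : Set (Fin n)) then some x else none) = _
  by_cases h : x = i <;> simp [h]

/-- The inclusion of the first `n` points, as a partial bijection. -/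
def incl {n N : ℕ} (h : n ≤ N) : Fin n ≃. Fin N where
  toFun x := some (Fin.castLE h x)
  invFun y := if hy : y.val < n then some ⟨y.val, hy⟩ else none
  inv x y := by
    by_cases hy : y.val < n
    · simp [hy, Fin.ext_iff, eq_comm]
    · simp only [hy, dite_false, reduceCtorEq, Option.some.injEq, false_iff]
      rintro rfl
      exact hy x.2

/-- The canonical projection: strike out the last row and the last column of the matrix. -/
def thetaP {n : ℕ} (γ : PBij (n + 1)) : PBij n :=
  ((incl (Nat.le_succ n)).trans γ).trans (incl (Nat.le_succ n)).symm

/-- The underlying function of the canonical embedding. -/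
def phiFun {m N : ℕ} (h : m ≤ N) (γ : PBij m) (x : Fin N) : Option (Fin N) :=
  if hx : x.val < m then (γ ⟨x.val, hx⟩).map (Fin.castLE h) else some x

/-- The canonical embedding: extend `γ` by fixing all points beyond the first `m`. -/
def phiP {m N : ℕ} (h : m ≤ N) (γ : PBij m) : PBij N where
  toFun := phiFun h γ
  invFun := phiFun h γ.symm
  inv a b := by
    have key : ∀ (γ : PBij m) (a b : Fin N), phiFun h γ a = some b → phiFun h γ.symm b = some a := by
      intro γ a b hab
      unfold phiFun at hab ⊢
      by_cases ha : a.val < m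
      · simp only [ha, dite_true, Option.map_eq_some_iff] at hab
        obtain ⟨c, hc, rfl⟩ := hab
        have : γ.symm c = some ⟨a.val, ha⟩ := (PEquiv.eq_some_iff γ).2 hc
        have hc' : (Fin.castLE h c).val < m := c.2
        simp only [hc', dite_true, Option.map_eq_some_iff]
        exact ⟨_, this, rfl⟩
      · simp only [ha, dite_false, Option.some.injEq] at hab
        subst hab
        simp [ha]
    exact ⟨fun hh => key γ.symm b a hh, fun hh => key γ a b hh⟩

theorem phiP_apply {m N : ℕ} (h : m ≤ N) (γ : PBij m) (x : Fin N) :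
    phiP h γ x = if hx : x.val < m then (γ ⟨x.val, hx⟩).map (Fin.castLE h) else some x := rfl

/-- The canonical embedding as a homomorphism. -/
def phiHom {m N : ℕ} (h : m ≤ N) : PBij m →* PBij N where
  toFun := phiP h
  map_one' := by
    ext1 x
    rw [phiP_apply, one_apply]
    split_ifs with hx
    · simp [one_apply]
    · rfl
  map_mul' f g := by
    ext1 x
    rw [mul_apply, phiP_apply, phiP_apply]
    split_ifs with hx
    · rw [mul_apply]
      rcases hg : g ⟨x.val, hx⟩ with _ | y
      · rfl
      · simp [phiP_apply]
    · simp [phiP_apply, hx]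

/-- The semigroup `Γ_m(n)`: those `γ` whose first `m` diagonal matrix entries are `1`. -/
def fixFirst (m n : ℕ) : Set (PBij n) := {γ | ∀ i : Fin n, i.val < m → γ i = some i}

/-- The degree of `γ`: the number of diagonal matrix entries of `γ` that are `0`. -/
def degP {n : ℕ} (γ : PBij n) : ℕ := (Finset.univ.filter fun i : Fin n => γ i ≠ some i).card

theorem degP_mul {n : ℕ} (f g : PBij n) : degP (f * g) ≤ degP f + degP g := by
  classical
  unfold degP
  refine le_trans (Finset.card_le_card ?_) (Finset.card_union_le _ _)
  intro i hi
  simp only [Finset.mem_filter, Finset.mem_univ, true_and, Finset.mem_union] at hi ⊢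
  by_contra hcon
  push Not at hcon
  exact hi (by rw [mul_apply, hcon.2]; exact hcon.1)

theorem degP_one {n : ℕ} : degP (1 : PBij n) = 0 := by
  simp [degP, one_apply]

/-! ### The semigroup algebras, their filtrations and centralizers -/

/-- The semigroup algebra `A(n) = ℂ[Γ(n)]`. -/
abbrev SAlg (n : ℕ) : Type := MonoidAlgebra ℂ (PBij n)

/-- The basis element of `A(n)` given by `γ`. -/
def gam {n : ℕ} (γ : PBij n) : SAlg n := MonoidAlgebra.of ℂ (PBij n) γ

theorem gam_mul {n : ℕ} (f g : PBij n) : gam (f * g) = gam f * gam g := map_mul _ f g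

theorem gam_one {n : ℕ} : gam (1 : PBij n) = 1 := map_one _

/-- The `M`-th term of the filtration of `A(n)`: the span of the `γ` of degree at most `M`. -/
def filt (n M : ℕ) : Submodule ℂ (SAlg n) := Submodule.span ℂ (gam '' {γ : PBij n | degP γ ≤ M})

theorem gam_mem_filt {n M : ℕ} {γ : PBij n} (h : degP γ ≤ M) : gam γ ∈ filt n M :=
  Submodule.subset_span ⟨γ, h, rfl⟩

theorem filt_mono {n M N : ℕ} (h : M ≤ N) : filt n M ≤ filt n N :=
  Submodule.span_mono (Set.image_mono fun _ hγ => le_trans hγ h)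

theorem filt_mul {n M N : ℕ} {a b : SAlg n} (ha : a ∈ filt n M) (hb : b ∈ filt n N) :
    a * b ∈ filt n (M + N) := by
  have h : filt n M * filt n N ≤ filt n (M + N) := by
    rw [filt, filt, Submodule.span_mul_span]
    refine Submodule.span_le.2 ?_
    rintro _ ⟨_, ⟨f, hf, rfl⟩, _, ⟨g, hg, rfl⟩, rfl⟩
    change gam f * gam g ∈ _
    rw [← gam_mul]
    exact gam_mem_filt (le_trans (degP_mul f g) (add_le_add hf hg))
  exact h (Submodule.mul_mem_mul ha hb)

theorem one_mem_filt {n M : ℕ} : (1 : SAlg n) ∈ filt n M := by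
  rw [← gam_one]
  exact gam_mem_filt (by rw [degP_one]; exact Nat.zero_le _)

/-- `A_m(n)`: the centralizer of `Γ_m(n)` in `A(n)`. -/
def centr (m n : ℕ) : Subalgebra ℂ (SAlg n) := Subalgebra.centralizer ℂ (gam '' fixFirst m n)

theorem mem_centr {m n : ℕ} {a : SAlg n} :
    a ∈ centr m n ↔ ∀ γ ∈ fixFirst m n, gam γ * a = a * gam γ := by
  simp [centr, Subalgebra.mem_centralizer_iff]

/-- The linear extension `θ_{n+1} : A(n+1) → A(n)` of the canonical projection. -/
def theta (n : ℕ) : SAlg (n + 1) →ₗ[ℂ] SAlg n := MonoidAlgebra.mapDomainLinearMap ℂ ℂ thetaP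

/-- The embedding `A(m) → A(N)`, the linear extension of the canonical embedding. -/
def phi {m N : ℕ} (h : m ≤ N) : SAlg m →ₐ[ℂ] SAlg N := MonoidAlgebra.mapDomainAlgHom ℂ ℂ (phiHom h)

theorem theta_gam {n : ℕ} (γ : PBij (n + 1)) : theta n (gam γ) = gam (thetaP γ) := by
  simp [theta, gam]

theorem phi_gam {m N : ℕ} (h : m ≤ N) (γ : PBij m) : phi h (gam γ) = gam (phiP h γ) := by
  simp [phi, gam, phiHom]

theorem incl_symm_trans_incl {n : ℕ} :
    (incl (Nat.le_succ n)).symm.trans (incl (Nat.le_succ n)) = epsP (Fin.last n) := by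
  ext1 x
  rw [epsP_apply]
  change (if hy : x.val < n then some (⟨x.val, hy⟩ : Fin n) else none).bind
    (fun y => some (Fin.castLE (Nat.le_succ n) y)) = _
  by_cases hx : x.val < n
  · have : x ≠ Fin.last n := fun h => by simp [h] at hx
    simp [hx, this]
  · have : x = Fin.last n := by
      apply Fin.ext
      have := x.2
      simp only [Fin.val_last]
      omega
    simp [this]

theorem incl_trans_symm {n : ℕ} :
    (incl (Nat.le_succ n)).trans (incl (Nat.le_succ n)).symm = PEquiv.refl (Fin n) := by
  ext1 x
  change (if hy : x.val < n then some (⟨x.val, hy⟩ : Fin n) else none) = some x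
  simp

/-- The `0`-embedding of the partial bijections of the first `n` points. -/
def zetaP {n : ℕ} (γ : PBij n) : PBij (n + 1) :=
  ((incl (Nat.le_succ n)).symm.trans γ).trans (incl (Nat.le_succ n))

/-- The `0`-embedding as a homomorphism of semigroups. -/
def zetaHom (n : ℕ) : PBij n →ₙ* PBij (n + 1) where
  toFun := zetaP
  map_mul' f g := by
    simp only [zetaP, mul_def]
    have h : ∀ p : Fin n ≃. Fin (n + 1), (incl (Nat.le_succ n)).trans
        ((incl (Nat.le_succ n)).symm.trans p) = p := fun p => by
      rw [← PEquiv.trans_assoc, incl_trans_symm, PEquiv.refl_trans]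
    simp only [PEquiv.trans_assoc, h]

theorem thetaP_zetaP {n : ℕ} (γ : PBij n) : thetaP (zetaP γ) = γ := by
  have h : ∀ p : Fin n ≃. Fin n, (incl (Nat.le_succ n)).trans
      ((incl (Nat.le_succ n)).symm.trans p) = p := fun p => by
    rw [← PEquiv.trans_assoc, incl_trans_symm, PEquiv.refl_trans]
  simp only [thetaP, zetaP, PEquiv.trans_assoc, incl_trans_symm, PEquiv.trans_refl, h]

theorem zetaP_thetaP {n : ℕ} (γ : PBij (n + 1)) :
    zetaP (thetaP γ) = epsP (Fin.last n) * γ * epsP (Fin.last n) := by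
  simp only [thetaP, zetaP, mul_def, ← incl_symm_trans_incl, PEquiv.trans_assoc]

theorem epsP_mul_self {n : ℕ} (i : Fin n) : epsP i * epsP i = epsP i := by
  ext1 x
  rw [mul_apply, epsP_apply]
  split_ifs with h
  · rfl
  · simp [epsP_apply, h]

/-- The linear extension of the `0`-embedding. -/
def zeta (n : ℕ) : SAlg n →ₙ+* SAlg (n + 1) := MonoidAlgebra.mapDomainNonUnitalRingHom ℂ (zetaHom n)

theorem zeta_injective (n : ℕ) : Function.Injective (zeta n) :=
  MonoidAlgebra.mapDomain_injective fun f g h => by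
    have h' : zetaP f = zetaP g := h
    rw [← thetaP_zetaP f, h', thetaP_zetaP]

theorem zeta_theta {n : ℕ} (a : SAlg (n + 1)) :
    zeta n (theta n a) = gam (epsP (Fin.last n)) * a * gam (epsP (Fin.last n)) := by
  induction a using MonoidAlgebra.induction_linear with
  | zero => simp
  | add a b ha hb => simp [ha, hb, mul_add, add_mul]
  | single γ r =>
    simp only [theta, zeta, gam, MonoidAlgebra.mapDomainLinearMap_single,
      MonoidAlgebra.of_apply, MonoidAlgebra.single_mul_single, one_mul, mul_one]
    rw [← zetaP_thetaP]
    exact MonoidAlgebra.mapDomain_single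

theorem theta_mul {n : ℕ} {a : SAlg (n + 1)} (b : SAlg (n + 1))
    (ha : gam (epsP (Fin.last n)) * a = a * gam (epsP (Fin.last n))) :
    theta n (a * b) = theta n a * theta n b := by
  apply zeta_injective
  rw [map_mul (zeta n), zeta_theta, zeta_theta, zeta_theta, ha]
  have he : gam (epsP (Fin.last n)) * gam (epsP (Fin.last n)) = gam (epsP (Fin.last n)) := by
    rw [← gam_mul, epsP_mul_self]
  rw [mul_assoc a, he, mul_assoc a, ← mul_assoc (gam _) (gam _ * b), ← mul_assoc (gam _) (gam _) b,
    he, ← mul_assoc a, ← mul_assoc a, ← mul_assoc _ a b, ha]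

theorem epsP_mem_fixFirst {m n : ℕ} {i : Fin n} (h : m ≤ i.val) : epsP i ∈ fixFirst m n := by
  intro x hx
  rw [epsP_apply, if_neg]
  rintro rfl
  omega

theorem thetaP_one {n : ℕ} : thetaP (1 : PBij (n + 1)) = 1 := by
  rw [thetaP, one_def, one_def, PEquiv.trans_refl, incl_trans_symm]

theorem theta_one {n : ℕ} : theta n 1 = 1 := by
  rw [← gam_one, theta_gam, thetaP_one, gam_one]

/-! ### The limit algebra -/

/-- The algebra `A_m`: the projective limit, in the category of filtered algebras, of the algebras
`A_m(n)`, `n ≥ m`. Its elements are the sequences `(a_n)`, indexed here by `j = n - m`, such that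
`a_n ∈ A_m(n)`, `θ_n(a_n) = a_{n-1}` and the degrees of the `a_n` are bounded. -/
def limAlg (m : ℕ) : Subalgebra ℂ (∀ j : ℕ, SAlg (m + j)) where
  carrier := {a | (∀ j, a j ∈ centr m (m + j)) ∧ (∀ j, theta (m + j) (a (j + 1)) = a j) ∧
    ∃ M : ℕ, ∀ j, a j ∈ filt (m + j) M}
  mul_mem' := by
    rintro a b ⟨ha, ha', M, hM⟩ ⟨hb, hb', N, hN⟩
    refine ⟨fun j => mul_mem (ha j) (hb j), fun j => ?_, M + N, fun j => filt_mul (hM j) (hN j)⟩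
    have h := theta_mul (n := m + j) (a := a (j + 1)) (b (j + 1))
      (mem_centr.1 (ha (j + 1)) _ (epsP_mem_fixFirst (by simp)))
    rw [ha', hb'] at h
    exact h
  add_mem' := by
    rintro a b ⟨ha, ha', M, hM⟩ ⟨hb, hb', N, hN⟩
    refine ⟨fun j => add_mem (ha j) (hb j), fun j => ?_, max M N, fun j =>
      add_mem (filt_mono (le_max_left M N) (hM j)) (filt_mono (le_max_right M N) (hN j))⟩
    rw [Pi.add_apply, map_add, ha', hb']
    rfl
  algebraMap_mem' r := by
    refine ⟨fun j => Subalgebra.algebraMap_mem _ r, fun j => ?_, 0, fun j => ?_⟩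
    · simp only [Pi.algebraMap_apply, Algebra.algebraMap_eq_smul_one, map_smul]
      exact congrArg _ theta_one
    · simp only [Pi.algebraMap_apply, Algebra.algebraMap_eq_smul_one]
      exact Submodule.smul_mem _ _ one_mem_filt

theorem phiP_mem_comm {m N : ℕ} (h : m ≤ N) (f : PBij m) {γ : PBij N} (hγ : γ ∈ fixFirst m N) :
    γ * phiP h f = phiP h f * γ := by
  have key : ∀ (f : PBij m) {γ : PBij N} (x y : Fin N), γ ∈ fixFirst m N →
      γ x = some y → m ≤ x.val → m ≤ y.val := by
    intro f γ x y hγ hxy hx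
    by_contra hy
    have h1 : γ y = some y := hγ y (by omega)
    have : x = y := γ.inj hxy h1
    omega
  ext1 x
  rw [mul_apply, mul_apply, phiP_apply]
  split_ifs with hx
  · rw [hγ x hx]
    rcases hf : f ⟨x.val, hx⟩ with _ | y
    · simp [phiP_apply, hx, hf]
    · simpa [phiP_apply, hx, hf] using hγ (Fin.castLE h y) y.2
  · rcases hg : γ x with _ | y
    · simp [hg]
    · have := key f x y hγ hg (by omega)
      simp [hg, phiP_apply, this]

theorem phi_mem_centr {m N : ℕ} (h : m ≤ N) (b : SAlg m) : phi h b ∈ centr m N := by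
  rw [mem_centr]
  intro γ hγ
  induction b using MonoidAlgebra.induction_linear with
  | zero => simp
  | add a b ha hb => simp [ha, hb, mul_add, add_mul]
  | single f r =>
    have : (MonoidAlgebra.single f r : SAlg m) = r • gam f := by simp [gam]
    rw [this, map_smul, phi_gam, mul_smul_comm, smul_mul_assoc, ← gam_mul, ← gam_mul,
      phiP_mem_comm h f hγ]

theorem thetaP_phiP {m n : ℕ} (h : m ≤ n) (f : PBij m) :
    thetaP (phiP (Nat.le_succ_of_le h) f) = phiP h f := by
  ext1 x
  change (phiP (Nat.le_succ_of_le h) f (Fin.castLE (Nat.le_succ n) x)).bind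
    (incl (Nat.le_succ n)).symm = _
  rw [phiP_apply, phiP_apply]
  have hs : ∀ y : Fin (n + 1), (incl (Nat.le_succ n)).symm y =
      if hy : y.val < n then some (⟨y.val, hy⟩ : Fin n) else none := fun _ => rfl
  by_cases hx : x.val < m
  · rcases hf : f ⟨x.val, hx⟩ with _ | y
    · simp [hx, hf]
    · have : y.val < n := by omega
      simp [hx, hf, hs, this, Fin.ext_iff]
  · simp [hx, hs]

theorem theta_phi {m n : ℕ} (h : m ≤ n) (b : SAlg m) :
    theta n (phi (Nat.le_succ_of_le h) b) = phi h b := by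
  induction b using MonoidAlgebra.induction_linear with
  | zero => simp
  | add a b ha hb => simp [ha, hb]
  | single f r =>
    have : (MonoidAlgebra.single f r : SAlg m) = r • gam f := by simp [gam]
    rw [this, map_smul, phi_gam, map_smul, map_smul, phi_gam, theta_gam, thetaP_phiP]

theorem degP_phiP_le {m N : ℕ} (h : m ≤ N) (f : PBij m) : degP (phiP h f) ≤ m := by
  classical
  unfold degP
  have : (Finset.univ.filter fun i : Fin N => phiP h f i ≠ some i) ⊆
      Finset.univ.image (Fin.castLE h) := by
    intro i hi
    simp only [Finset.mem_filter, Finset.mem_univ, true_and, phiP_apply] at hi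
    by_cases hx : i.val < m
    · exact Finset.mem_image.2 ⟨⟨i.val, hx⟩, Finset.mem_univ _, rfl⟩
    · simp [hx] at hi
  refine (Finset.card_le_card this).trans (Finset.card_image_le.trans ?_)
  simp

theorem phi_mem_filt {m N : ℕ} (h : m ≤ N) (b : SAlg m) : phi h b ∈ filt N m := by
  induction b using MonoidAlgebra.induction_linear with
  | zero => simp
  | add a b ha hb => rw [map_add]; exact add_mem ha hb
  | single f r =>
    have : (MonoidAlgebra.single f r : SAlg m) = r • gam f := by simp [gam]
    rw [this, map_smul, phi_gam]
    exact Submodule.smul_mem _ _ (gam_mem_filt (degP_phiP_le h f))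

/-- The embedding of `A(m)` into `A_m` by stable sequences. -/
def stab (m : ℕ) : SAlg m →ₐ[ℂ] limAlg m :=
  AlgHom.codRestrict (AlgHom.pi fun j : ℕ => phi (Nat.le_add_right m j))
    (limAlg m) fun b => ⟨fun _ => phi_mem_centr _ b, fun j => theta_phi (Nat.le_add_right m j) b,
      m, fun _ => phi_mem_filt _ b⟩

/-! ### The elements `u_k` -/

/-- The summand `(k i)(1 - ε_k)(1 - ε_i)`. -/
def uTerm {n : ℕ} (k i : Fin n) : SAlg n := gam (swapP k i) * (1 - gam (epsP k)) * (1 - gam (epsP i))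

/-- The element `u_{k|n} = ∑_{i > k} (k i)(1 - ε_k)(1 - ε_i)` of `A(n)`. -/
def uFin {n : ℕ} (k : Fin n) : SAlg n := ∑ i ∈ Finset.univ.filter (fun i => k < i), uTerm k i

theorem gam_mul_one_sub_eps {n : ℕ} {γ : PBij n} {i j : Fin n} (h : γ i = some j) :
    gam γ * (1 - gam (epsP i)) = (1 - gam (epsP j)) * gam γ := by
  rw [mul_sub, sub_mul, mul_one, one_mul, ← gam_mul, ← gam_mul]
  congr 2
  ext1 x
  rw [mul_apply, mul_apply, epsP_apply]
  split_ifs with hx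
  · subst hx
    simp [h, epsP_apply]
  · rcases hg : γ x with _ | y
    · simp [hg]
    · have : y ≠ j := by
        rintro rfl
        exact hx (γ.inj hg h)
      simp [hg, epsP_apply, this]

theorem gam_mul_one_sub_eps_of_none {n : ℕ} {γ : PBij n} {i : Fin n} (h : γ i = none) :
    gam γ * (1 - gam (epsP i)) = 0 := by
  rw [mul_sub, mul_one, ← gam_mul, sub_eq_zero]
  congr 1
  ext1 x
  rw [mul_apply, epsP_apply]
  split_ifs with hx
  · subst hx
    simp [h]
  · simp

theorem one_sub_eps_mul_gam_of_none {n : ℕ} {γ : PBij n} {j : Fin n} (h : γ.symm j = none) :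
    (1 - gam (epsP j)) * gam γ = 0 := by
  rw [sub_mul, one_mul, ← gam_mul, sub_eq_zero]
  congr 1
  ext1 x
  rw [mul_apply]
  rcases hg : γ x with _ | y
  · rfl
  · have : y ≠ j := by
      rintro rfl
      rw [(PEquiv.eq_some_iff γ).2 hg] at h
      simp at h
    simp [epsP_apply, this]

theorem gam_swap_mul_eps {n : ℕ} (k i : Fin n) :
    gam (swapP k i) * (1 - gam (epsP k)) = (1 - gam (epsP i)) * gam (swapP k i) :=
  gam_mul_one_sub_eps (by simp [swapP_apply])

theorem gam_mul_uTerm {n : ℕ} {γ : PBij n} {k i j : Fin n} (hk : γ k = some k)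
    (h : γ i = some j) : gam γ * uTerm k i = uTerm k j * gam γ := by
  have hs : γ * swapP k i = swapP k j * γ := by
    ext1 x
    rw [mul_apply, mul_apply, swapP_apply, Option.bind_some]
    by_cases hxk : x = k
    · subst hxk
      simp [hk, h, swapP_apply]
    by_cases hxi : x = i
    · subst hxi
      simp [hk, h, swapP_apply]
    rw [Equiv.swap_apply_of_ne_of_ne hxk hxi]
    rcases hg : γ x with _ | y
    · rfl
    · have h1 : y ≠ k := by
        rintro rfl
        exact hxk (γ.inj hg hk)
      have h2 : y ≠ j := by
        rintro rfl
        exact hxi (γ.inj hg h)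
      simp [swapP_apply, Equiv.swap_apply_of_ne_of_ne h1 h2]
  unfold uTerm
  rw [← mul_assoc, ← mul_assoc, ← gam_mul, hs, gam_mul, mul_assoc (gam _) (gam γ),
    gam_mul_one_sub_eps hk, ← mul_assoc, mul_assoc _ (gam γ), gam_mul_one_sub_eps h, ← mul_assoc]

theorem gam_mul_uTerm_of_none {n : ℕ} {γ : PBij n} {k i : Fin n}
    (h : γ i = none) : gam γ * uTerm k i = 0 := by
  unfold uTerm
  rw [gam_swap_mul_eps, ← mul_assoc, ← mul_assoc, gam_mul_one_sub_eps_of_none h, zero_mul, zero_mul]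

theorem uTerm_mul_gam_of_none {n : ℕ} {γ : PBij n} {k j : Fin n}
    (h : γ.symm j = none) : uTerm k j * gam γ = 0 := by
  unfold uTerm
  rw [mul_assoc, one_sub_eps_mul_gam_of_none h, mul_zero]

theorem gam_mul_uFin {n : ℕ} {γ : PBij n} {k : Fin n} (hγ : ∀ i : Fin n, i ≤ k → γ i = some i) :
    gam γ * uFin k = uFin k * gam γ := by
  classical
  have hk := hγ k le_rfl
  have hup : ∀ i j : Fin n, γ i = some j → (k < i ↔ k < j) := by
    intro i j hij
    constructor
    · intro h
      by_contra hj
      have := γ.inj hij (hγ j (not_lt.1 hj))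
      subst this
      exact hj h
    · intro h
      by_contra hi
      have := hγ i (not_lt.1 hi)
      rw [hij] at this
      exact hi (Option.some.inj this ▸ h)
  have hL : ∀ i ∈ Finset.univ.filter (fun i => k < i), gam γ * uTerm k i =
      ∑ j ∈ Finset.univ.filter (fun j => k < j), if γ i = some j then uTerm k j * gam γ else 0 := by
    intro i hi
    simp only [Finset.mem_filter, Finset.mem_univ, true_and] at hi
    rcases h : γ i with _ | j
    · rw [gam_mul_uTerm_of_none h]
      simp
    · rw [gam_mul_uTerm hk h, Finset.sum_eq_single j]
      · simp
      · intro b _ hb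
        rw [if_neg]
        intro hh
        exact hb (Option.some.inj hh).symm
      · intro hj
        exact absurd ((hup i j h).1 hi) (by simpa using hj)
  have hR : ∀ j ∈ Finset.univ.filter (fun j => k < j), uTerm k j * gam γ =
      ∑ i ∈ Finset.univ.filter (fun i => k < i), if γ i = some j then uTerm k j * gam γ else 0 := by
    intro j hj
    simp only [Finset.mem_filter, Finset.mem_univ, true_and] at hj
    rcases h : γ.symm j with _ | i
    · rw [uTerm_mul_gam_of_none h]
      simp
    · have h' := (PEquiv.eq_some_iff γ).1 h
      rw [Finset.sum_eq_single i]
      · simp [h']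
      · intro b _ hb
        rw [if_neg]
        intro hh
        exact hb (γ.inj hh h')
      · intro hi
        exact absurd ((hup i j h').2 hj) (by simpa using hi)
  unfold uFin
  rw [Finset.mul_sum, Finset.sum_mul, Finset.sum_congr rfl hL, Finset.sum_congr rfl hR,
    Finset.sum_comm]

theorem degP_epsP_le {n : ℕ} (i : Fin n) : degP (epsP i) ≤ 1 := by
  unfold degP
  refine (Finset.card_le_card (t := {i}) ?_).trans (by simp)
  intro x hx
  simp only [Finset.mem_filter, Finset.mem_univ, true_and, epsP_apply] at hx
  by_contra hxi
  simp only [Finset.mem_singleton] at hxi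
  simp [hxi] at hx

theorem degP_swapP_le {n : ℕ} (k i : Fin n) : degP (swapP k i) ≤ 2 := by
  classical
  unfold degP
  refine (Finset.card_le_card (t := {k, i}) ?_).trans Finset.card_le_two
  intro x hx
  simp only [Finset.mem_filter, Finset.mem_univ, true_and, swapP_apply] at hx
  by_contra hxi
  simp only [Finset.mem_insert, Finset.mem_singleton, not_or] at hxi
  simp [Equiv.swap_apply_of_ne_of_ne hxi.1 hxi.2] at hx

theorem uFin_mem_filt {n : ℕ} (k : Fin n) : uFin k ∈ filt n (2 + 1 + 1) := by
  have he : ∀ i : Fin n, (1 - gam (epsP i)) ∈ filt n 1 := fun i =>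
    sub_mem one_mem_filt (gam_mem_filt (degP_epsP_le i))
  have ht : ∀ i : Fin n, uTerm k i ∈ filt n (2 + 1 + 1) := fun i =>
    filt_mul (filt_mul (gam_mem_filt (degP_swapP_le k i)) (he k)) (he i)
  exact Submodule.sum_mem _ fun i _ => ht i

theorem thetaP_mul_eps_last {n : ℕ} (γ : PBij (n + 1)) :
    thetaP (γ * epsP (Fin.last n)) = thetaP γ := by
  simp only [thetaP, mul_def, ← incl_symm_trans_incl, ← PEquiv.trans_assoc, incl_trans_symm,
    PEquiv.refl_trans]

theorem theta_mul_one_sub_last {n : ℕ} (a : SAlg (n + 1)) :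
    theta n (a * (1 - gam (epsP (Fin.last n)))) = 0 := by
  induction a using MonoidAlgebra.induction_linear with
  | zero => simp
  | add a b ha hb => simp only [add_mul, map_add, ha, hb, add_zero]
  | single f r =>
    have : (MonoidAlgebra.single f r : SAlg (n + 1)) = r • gam f := by simp [gam]
    rw [this, smul_mul_assoc, map_smul, mul_sub, mul_one, ← gam_mul, map_sub, theta_gam, theta_gam,
      thetaP_mul_eps_last, sub_self, smul_zero]

theorem phiP_epsP {n N : ℕ} (h : n ≤ N) (i : Fin n) :
    phiP h (epsP i) = epsP (Fin.castLE h i) := by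
  ext1 x
  rw [phiP_apply, epsP_apply]
  by_cases hx : x.val < n
  · simp only [hx, dite_true, epsP_apply, Fin.ext_iff, Fin.val_castLE]
    split_ifs <;> simp
  · have : x ≠ Fin.castLE h i := by
      rintro rfl
      exact hx i.2
    simp [hx, this]

theorem phiP_swapP {n N : ℕ} (h : n ≤ N) (k i : Fin n) :
    phiP h (swapP k i) = swapP (Fin.castLE h k) (Fin.castLE h i) := by
  ext1 x
  rw [phiP_apply, swapP_apply]
  by_cases hx : x.val < n
  · simp only [hx, dite_true, swapP_apply, Equiv.swap_apply_def, Fin.ext_iff, Fin.val_castLE]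
    split_ifs <;> simp
  · have h1 : x ≠ Fin.castLE h i := by
      rintro rfl
      exact hx i.2
    have h2 : x ≠ Fin.castLE h k := by
      rintro rfl
      exact hx k.2
    simp [hx, Equiv.swap_apply_of_ne_of_ne h2 h1]

theorem phi_uTerm {n N : ℕ} (h : n ≤ N) (k i : Fin n) :
    phi h (uTerm k i) = uTerm (Fin.castLE h k) (Fin.castLE h i) := by
  simp only [uTerm, map_mul, map_sub, map_one, phi_gam, phiP_epsP, phiP_swapP]

theorem phi_refl_apply {n : ℕ} (a : SAlg n) : phi le_rfl a = a := by
  induction a using MonoidAlgebra.induction_linear with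
  | zero => simp
  | add a b ha hb => rw [map_add, ha, hb]
  | single f r =>
    have : (MonoidAlgebra.single f r : SAlg n) = r • gam f := by simp [gam]
    rw [this, map_smul, phi_gam]
    congr 2
    ext1 x
    simp [phiP_apply]

theorem theta_uFin {n : ℕ} (k : Fin n) : theta n (uFin (Fin.castSucc k)) = uFin k := by
  unfold uFin
  rw [Finset.sum_filter, Fin.sum_univ_castSucc, map_add, map_sum, Finset.sum_filter]
  have h0 : theta n (if Fin.castSucc k < Fin.last n then uTerm (Fin.castSucc k) (Fin.last n)
      else 0) = 0 := by
    rw [if_pos (Fin.castSucc_lt_last k)]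
    exact theta_mul_one_sub_last _
  rw [h0, add_zero]
  refine Finset.sum_congr rfl fun i _ => ?_
  simp only [Fin.castSucc_lt_castSucc_iff]
  split_ifs
  · have h1 : uTerm (Fin.castSucc k) (Fin.castSucc i) = phi (Nat.le_succ n) (uTerm k i) :=
      (phi_uTerm (Nat.le_succ n) k i).symm
    rw [h1]
    exact (theta_phi le_rfl _).trans (phi_refl_apply _)
  · simp

/-- The element `u_k = (u_{k|n})_n` of `A_m`, for `k` among the first `m` points. -/
def uLim {m : ℕ} (k : Fin m) : limAlg m :=
  ⟨fun j => uFin (Fin.castLE (Nat.le_add_right m j) k),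
    fun _ => mem_centr.2 fun _ hγ => gam_mul_uFin fun i hi => hγ i (lt_of_le_of_lt hi k.2),
    fun j => theta_uFin (n := m + j) (Fin.castLE (Nat.le_add_right m j) k), 2 + 1 + 1,
    fun _ => uFin_mem_filt _⟩

/-! ### The two Hecke algebras -/

/-- The algebra `H̃_m`: the subalgebra of `A_m` generated by `A(m)` and `u_1, …, u_m`. -/
def semiHecke (m : ℕ) : Subalgebra ℂ (limAlg m) :=
  Algebra.adjoin ℂ (Set.range (stab m) ∪ Set.range (uLim (m := m)))

/-- An element of `A(m)`, as an element of `H̃_m`. -/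
def ofSAlg {m : ℕ} (b : SAlg m) : semiHecke m :=
  ⟨stab m b, Algebra.subset_adjoin (Or.inl ⟨b, rfl⟩)⟩

/-- The point `k` of the two points `k`, `k + 1` interchanged by `s_k`. -/
def lo {m : ℕ} (k : Fin (m - 1)) : Fin m := ⟨k.val, by omega⟩

/-- The point `k + 1` of the two points `k`, `k + 1` interchanged by `s_k`. -/
def hi {m : ℕ} (k : Fin (m - 1)) : Fin m := ⟨k.val + 1, by omega⟩

/-- The element `s_k = (k, k+1)` of `H̃_m`. -/
def sGen {m : ℕ} (k : Fin (m - 1)) : semiHecke m := ofSAlg (gam (swapP (lo k) (hi k)))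

/-- The element `ε_k` of `H̃_m`. -/
def epsGen {m : ℕ} (k : Fin m) : semiHecke m := ofSAlg (gam (epsP k))

/-- The element `u_k` of `H̃_m`. -/
def uGen {m : ℕ} (k : Fin m) : semiHecke m :=
  ⟨uLim k, Algebra.subset_adjoin (Or.inr ⟨k, rfl⟩)⟩

/-- The free algebra on `s_1, …, s_{m-1}` and `u_1, …, u_m`. -/
abbrev FreeSU (m : ℕ) : Type := FreeAlgebra ℂ (Fin (m - 1) ⊕ Fin m)

/-- The free generator `s_k`. -/
def fs {m : ℕ} (k : Fin (m - 1)) : FreeSU m := FreeAlgebra.ι ℂ (Sum.inl k)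

/-- The free generator `u_k`. -/
def fu {m : ℕ} (k : Fin m) : FreeSU m := FreeAlgebra.ι ℂ (Sum.inr k)

/-- The defining relations of the degenerate affine Hecke algebra. -/
inductive HeckeRel (m : ℕ) : FreeSU m → FreeSU m → Prop
  | s_sq (k : Fin (m - 1)) : HeckeRel m (fs k * fs k) 1
  | braid (k l : Fin (m - 1)) (h : l.val = k.val + 1) :
      HeckeRel m (fs k * fs l * fs k) (fs l * fs k * fs l)
  | s_comm (k l : Fin (m - 1)) (h : k.val + 1 < l.val ∨ l.val + 1 < k.val) :
      HeckeRel m (fs k * fs l) (fs l * fs k)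
  | s_u (k : Fin (m - 1)) : HeckeRel m (fs k * fu (lo k)) (fu (hi k) * fs k + 1)
  | s_u_comm (k : Fin (m - 1)) (l : Fin m) (h : l ≠ lo k) (h' : l ≠ hi k) :
      HeckeRel m (fs k * fu l) (fu l * fs k)
  | u_comm (k l : Fin m) : HeckeRel m (fu k * fu l) (fu l * fu k)

/-- The degenerate affine Hecke algebra `H_m`. -/
abbrev Hecke (m : ℕ) : Type := RingQuot (HeckeRel m)

/-- The generator `s_k` of `H_m`. -/
def sHecke {m : ℕ} (k : Fin (m - 1)) : Hecke m := RingQuot.mkAlgHom ℂ (HeckeRel m) (fs k)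

/-- The generator `u_k` of `H_m`. -/
def uHecke {m : ℕ} (k : Fin m) : Hecke m := RingQuot.mkAlgHom ℂ (HeckeRel m) (fu k)

end SemigroupHecke

end

/-! Killing every partial bijection that is not a permutation gives a homomorphism `A(n) → ℂ[S_n]`,
because a product of partial bijections of a finite set is total only if both factors are. It sends
each `ε_i` to `0`, hence `u_{k|n}` to the Jucys–Murphy element `∑_{i>k} (k i)`. Applied in every
component, it maps `H̃_m` to the product of the algebras `ℂ[S_n]`, `n ≥ m` (`semiToGroups`).
Jucys–Murphy elements satisfy the degenerate affine Hecke relations, so `H_m` maps to the same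
product (`heckeToGroups`). On generators the image of `H̃_m` lies in that of `H_m`. Once
`heckeToGroups` is known to be injective, inverting it on its range gives the required homomorphism.

Injectivity is the main point. The relations show that `H_m` is spanned by products `f w` with `f` a
polynomial in the `u_k` and `w` a permutation (`pbw_surjective`); this needs the Coxeter
presentation of `S_m` (`exists_hom_perm`) to make sense of `w` in `H_m`. If a combination of such
products is nonzero, take in it a monomial of maximal degree `d` and look in `S_{m+d}`: the monomial
yields products of transpositions `(l i)` whose `d` points `i` are distinct and lie outside `{1, …,
m}`. Such a permutation determines the monomial and `w` (`perm_of_swapProd_mul_eq`), so its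
coefficient cannot cancel (`eq_zero_of_toGAlg_pbw`).

Surjectivity holds because the generators are hit. Uniqueness holds because the `s_k` generate the
permutations and any other partial bijection is a multiple of some `ε_k`. -/

noncomputable section

namespace SemigroupHecke

/-! ### The Coxeter presentation of the symmetric group -/

section Coxeter

variable {P : Type*} [Monoid P] (g : ℕ → P)

/-- The product `g (r + i - 1) ⋯ g (r + 1) g r`. -/
def descProd (r : ℕ) : ℕ → P
  | 0 => 1
  | i + 1 => g (r + i) * descProd r i

variable {g}

/-- The indices of all factors differ from `k` by at least two, so only distant commutation is used.
-/
theorem mul_descProd_of_lt (hcomm : ∀ k l, k + 1 < l → g k * g l = g l * g k) {r k : ℕ} :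
    ∀ {i : ℕ}, r + i < k → g k * descProd g r i = descProd g r i * g k
  | 0, _ => by simp [descProd]
  | i + 1, h => by
    rw [descProd, ← mul_assoc, ← hcomm (r + i) k (by omega), mul_assoc,
      mul_descProd_of_lt hcomm (by omega), mul_assoc]

/-- `g k` passes the factors above `g (k + 1)`, the braid relation turns `g k * g (k + 1) * g k`
into `g (k + 1) * g k * g (k + 1)`, and the last `g (k + 1)` passes the rest. The bound by `n` keeps
the braid relation away from indices where `g` is padded by `1`, as it fails there. -/
theorem mul_descProd_of_gt {n : ℕ} (hcomm : ∀ k l, k + 1 < l → g k * g l = g l * g k)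
    (hbraid : ∀ k, k + 1 < n → g k * g (k + 1) * g k = g (k + 1) * g k * g (k + 1))
    {r k : ℕ} (hk : r ≤ k) :
    ∀ {i : ℕ}, k + 1 < r + i → r + i ≤ n → g k * descProd g r i = descProd g r i * g (k + 1)
  | 0, h, _ => by omega
  | i + 1, h, hn => by
    rcases Nat.lt_or_ge (k + 1) (r + i) with h' | h'
    · rw [descProd, ← mul_assoc, hcomm k (r + i) h', mul_assoc,
        mul_descProd_of_gt hcomm hbraid hk h' (by omega), mul_assoc]
    · obtain ⟨i, rfl⟩ : ∃ j, i = j + 1 := ⟨i - 1, by omega⟩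
      obtain rfl : k = r + i := by omega
      rw [descProd, descProd, ← add_assoc, ← mul_assoc, ← mul_assoc, hbraid _ (by omega),
        mul_assoc, mul_descProd_of_lt hcomm (by omega), ← mul_assoc, mul_assoc (g (r + i + 1))]

/-- The submonoid generated by the `g k` with `r ≤ k`. -/
def genFrom (g : ℕ → P) (r : ℕ) : Submonoid P := Submonoid.closure (g '' {k | r ≤ k})

theorem mem_genFrom {r k : ℕ} (h : r ≤ k) : g k ∈ genFrom g r :=
  Submonoid.subset_closure ⟨k, h, rfl⟩

/-- Normal form for one step of the coset chain of the symmetric group. Left multiplication by a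
generator lengthens or shortens the descending product, or moves past it as a generator of index at
least `r + 1`. -/
theorem eq_descProd_mul_of_mem_genFrom {n : ℕ} (hout : ∀ k, n ≤ k → g k = 1)
    (hsq : ∀ k, g k * g k = 1) (hcomm : ∀ k l, k + 1 < l → g k * g l = g l * g k)
    (hbraid : ∀ k, k + 1 < n → g k * g (k + 1) * g k = g (k + 1) * g k * g (k + 1))
    {r : ℕ} (hr : r ≤ n) {x : P} (hx : x ∈ genFrom g r) :
    ∃ i, r + i ≤ n ∧ ∃ y ∈ genFrom g (r + 1), x = descProd g r i * y := by
  induction hx using Submonoid.closure_induction_left with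
  | one => exact ⟨0, hr, 1, one_mem _, by simp [descProd]⟩
  | mul_left z hz x _ ih =>
    obtain ⟨k, hk : r ≤ k, rfl⟩ := hz
    obtain ⟨i, hi, y, hy, rfl⟩ := ih
    rcases Nat.lt_or_ge k n with hkn | hkn
    · rcases lt_trichotomy k (r + i) with h | h | h
      · obtain ⟨i, rfl⟩ : ∃ j, i = j + 1 := ⟨i - 1, by omega⟩
        rcases Nat.lt_or_ge k (r + i) with h' | h'
        · refine ⟨i + 1, hi, g (k + 1) * y, mul_mem (mem_genFrom (by omega)) hy, ?_⟩
          rw [← mul_assoc, mul_descProd_of_gt hcomm hbraid hk (by omega) hi, mul_assoc]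
        · obtain rfl : k = r + i := by omega
          refine ⟨i, by omega, y, hy, ?_⟩
          rw [descProd, ← mul_assoc, ← mul_assoc, hsq, one_mul]
      · subst h
        exact ⟨i + 1, by omega, y, hy, by rw [descProd, mul_assoc]⟩
      · refine ⟨i, hi, g k * y, mul_mem (mem_genFrom (by omega)) hy, ?_⟩
        rw [← mul_assoc, mul_descProd_of_lt hcomm h, mul_assoc]
    · exact ⟨i, hi, y, hy, by rw [hout k hkn, one_mul]⟩

end Coxeter

/-- The transposition of `k` and `k + 1`. -/
def adjSwap {m : ℕ} (k : Fin (m - 1)) : Equiv.Perm (Fin m) := Equiv.swap (lo k) (hi k)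

theorem closure_adjSwap (m : ℕ) : Submonoid.closure (Set.range (adjSwap (m := m))) = ⊤ := by
  rcases m with _ | m
  · exact Subsingleton.elim _ _
  · exact Equiv.Perm.mclosure_swap_castSucc_succ m

theorem adjSwap_sq {m : ℕ} (k : Fin (m - 1)) : adjSwap k * adjSwap k = 1 :=
  Equiv.swap_mul_self _ _

theorem adjSwap_comm {m : ℕ} (k l : Fin (m - 1)) (h : k.val + 1 < l.val ∨ l.val + 1 < k.val) :
    adjSwap k * adjSwap l = adjSwap l * adjSwap k := by
  apply Equiv.Perm.Disjoint.commute
  intro x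
  unfold adjSwap
  by_cases hx : x = lo k ∨ x = hi k
  · right
    apply Equiv.swap_apply_of_ne_of_ne <;> rcases hx with rfl | rfl <;>
      simp only [ne_eq, lo, hi, Fin.ext_iff] <;> omega
  · left
    exact Equiv.swap_apply_of_ne_of_ne (fun h => hx (.inl h)) (fun h => hx (.inr h))

theorem adjSwap_braid {m : ℕ} (k l : Fin (m - 1)) (h : l.val = k.val + 1) :
    adjSwap k * adjSwap l * adjSwap k = adjSwap l * adjSwap k * adjSwap l := by
  have e : hi k = lo l := Fin.ext h.symm
  have h1 : lo k ≠ lo l := by simp only [ne_eq, lo, Fin.ext_iff]; omega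
  have h2 : lo k ≠ hi l := by simp only [ne_eq, lo, hi, Fin.ext_iff]; omega
  have h3 : lo l ≠ hi l := by simp only [ne_eq, lo, hi, Fin.ext_iff]; omega
  unfold adjSwap
  rw [e]
  rw [Equiv.swap_mul_swap_mul_swap h1 h2, Equiv.swap_comm (hi l) (lo k),
    ← Equiv.swap_mul_swap_mul_swap h3.symm h2.symm, Equiv.swap_comm (hi l) (lo l),
    Equiv.swap_comm (lo l) (lo k)]

/-- Elements that satisfy the Coxeter relations of type `A` define a representation of the
symmetric group. -/
theorem exists_hom_perm {m : ℕ} {M : Type*} [Monoid M] (s : Fin (m - 1) → M)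
    (hsq : ∀ k, s k * s k = 1)
    (hbraid : ∀ k l : Fin (m - 1), l.val = k.val + 1 → s k * s l * s k = s l * s k * s l)
    (hcomm : ∀ k l : Fin (m - 1), k.val + 1 < l.val ∨ l.val + 1 < k.val → s k * s l = s l * s k) :
    ∃ T : Equiv.Perm (Fin m) →* M, ∀ k, T (adjSwap k) = s k := by
  -- The submonoid generated by these pairs will be the graph of the required homomorphism; the task
  -- is to show that its second projection is bijective.
  let g : ℕ → M × Equiv.Perm (Fin m) := fun k =>
    if h : k < m - 1 then (s ⟨k, h⟩, adjSwap ⟨k, h⟩) else 1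
  have hg : ∀ (k : ℕ) (h : k < m - 1), g k = (s ⟨k, h⟩, adjSwap ⟨k, h⟩) := fun k h => dif_pos h
  have gout : ∀ k, m - 1 ≤ k → g k = 1 := fun k h => dif_neg (by omega)
  have gsq : ∀ k, g k * g k = 1 := fun k => by
    rcases Nat.lt_or_ge k (m - 1) with h | h
    · rw [hg k h, Prod.mk_mul_mk, hsq, adjSwap_sq, Prod.one_eq_mk]
    · rw [gout k h, one_mul]
  have gcomm : ∀ k l, k + 1 < l → g k * g l = g l * g k := fun k l hkl => by
    rcases Nat.lt_or_ge l (m - 1) with h | h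
    · rw [hg k (by omega), hg l h, Prod.mk_mul_mk, Prod.mk_mul_mk, hcomm _ _ (.inl hkl),
        adjSwap_comm _ _ (.inl hkl)]
    · rw [gout l h, one_mul, mul_one]
  have gbraid : ∀ k, k + 1 < m - 1 → g k * g (k + 1) * g k = g (k + 1) * g k * g (k + 1) :=
    fun k h => by
      rw [hg k (by omega), hg (k + 1) h]
      simp only [Prod.mk_mul_mk]
      rw [hbraid _ _ rfl, adjSwap_braid _ _ rfl]
  have fix : ∀ (r : ℕ) (x : M × Equiv.Perm (Fin m)), x ∈ genFrom g r →
      ∀ p : Fin m, p.val < r → x.2 p = p := by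
    intro r x hx p hp
    induction hx using Submonoid.closure_induction with
    | mem x hx =>
      obtain ⟨k, hk : r ≤ k, rfl⟩ := hx
      rcases Nat.lt_or_ge k (m - 1) with h | h
      · rw [hg k h]
        apply Equiv.swap_apply_of_ne_of_ne <;> simp only [ne_eq, lo, hi, Fin.ext_iff] <;> omega
      · rw [gout k h]
        rfl
    | one => rfl
    | mul x y _ _ hx hy => rw [Prod.snd_mul, Equiv.Perm.mul_apply, hy, hx]
  have move : ∀ (r i : ℕ) (h : r + i < m),
      (descProd g r i).2 ⟨r, by omega⟩ = ⟨r + i, h⟩ := by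
    intro r i h
    induction i with
    | zero => rfl
    | succ i ih =>
      rw [descProd, Prod.snd_mul, Equiv.Perm.mul_apply, ih (by omega), hg (r + i) (by omega)]
      exact Equiv.swap_apply_left _ _
  -- Downward induction on `r`, with `d` bounding the distance to `m - 1`, where the submonoid is
  -- trivial.
  have inj : ∀ (d r : ℕ), m - 1 ≤ r + d → ∀ x ∈ genFrom g r, ∀ y ∈ genFrom g r,
      x.2 = y.2 → x = y := by
    intro d
    induction d with
    | zero =>
      intro r hr x hx y hy _
      have : genFrom g r = ⊥ := by
        rw [genFrom, eq_bot_iff, Submonoid.closure_le]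
        rintro _ ⟨k, hk : r ≤ k, rfl⟩
        exact gout k (by omega)
      rw [this, Submonoid.mem_bot] at hx hy
      rw [hx, hy]
    | succ d ih =>
      intro r hr x hx y hy hxy
      rcases Nat.lt_or_ge r (m - 1) with h | h
      · obtain ⟨i, hi, x, hx', rfl⟩ :=
          eq_descProd_mul_of_mem_genFrom gout gsq gcomm gbraid h.le hx
        obtain ⟨j, hj, y, hy', rfl⟩ :=
          eq_descProd_mul_of_mem_genFrom gout gsq gcomm gbraid h.le hy
        -- The second factors fix the point `r` and the descending products send it to `r + i` and
        -- `r + j`, so the normal forms have `i = j`.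
        have e := congrArg (fun σ : Equiv.Perm (Fin m) => σ ⟨r, by omega⟩) hxy
        simp only [Prod.snd_mul, Equiv.Perm.mul_apply] at e
        rw [fix _ x hx' _ (Nat.lt_succ_self r), fix _ y hy' _ (Nat.lt_succ_self r),
          move r i (by omega), move r j (by omega), Fin.mk.injEq] at e
        obtain rfl : i = j := by omega
        rw [Prod.snd_mul, Prod.snd_mul, mul_right_inj] at hxy
        rw [ih (r + 1) (by omega) x hx' y hy' hxy]
      · exact ih r (by omega) x hx y hy hxy
  let pr : genFrom g 0 →* Equiv.Perm (Fin m) :=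
    (MonoidHom.snd M (Equiv.Perm (Fin m))).comp (genFrom g 0).subtype
  have hmem : ∀ k : Fin (m - 1), (s k, adjSwap k) ∈ genFrom g 0 := fun k => by
    rw [← hg k.1 k.2]
    exact mem_genFrom (Nat.zero_le _)
  have prinj : Function.Injective pr := fun x y h =>
    Subtype.ext (inj (m - 1) 0 (by omega) x x.2 y y.2 h)
  have prsurj : Function.Surjective pr := by
    rw [← MonoidHom.mrange_eq_top, eq_top_iff, ← closure_adjSwap, Submonoid.closure_le]
    rintro _ ⟨k, rfl⟩
    exact ⟨⟨_, hmem k⟩, rfl⟩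
  let e : genFrom g 0 ≃* Equiv.Perm (Fin m) := MulEquiv.ofBijective pr ⟨prinj, prsurj⟩
  refine ⟨((MonoidHom.fst M _).comp (genFrom g 0).subtype).comp e.symm.toMonoidHom, fun k => ?_⟩
  have : e.symm (adjSwap k) = ⟨_, hmem k⟩ := by
    rw [MulEquiv.symm_apply_eq]
    rfl
  simp [this]

/-! ### Spanning elements of the degenerate affine Hecke algebra -/

section Relations

variable {m : ℕ}

theorem mkAlgHom_eq {a b : FreeSU m} (h : HeckeRel m a b) :
    RingQuot.mkAlgHom ℂ (HeckeRel m) a = RingQuot.mkAlgHom ℂ (HeckeRel m) b :=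
  RingQuot.mkAlgHom_rel ℂ h

theorem sHecke_sq (k : Fin (m - 1)) : sHecke k * sHecke k = 1 := by
  simpa [sHecke, uHecke] using mkAlgHom_eq (HeckeRel.s_sq k)

theorem sHecke_braid (k l : Fin (m - 1)) (h : l.val = k.val + 1) :
    sHecke k * sHecke l * sHecke k = sHecke l * sHecke k * sHecke l := by
  simpa [sHecke, uHecke] using mkAlgHom_eq (HeckeRel.braid k l h)

theorem sHecke_comm (k l : Fin (m - 1)) (h : k.val + 1 < l.val ∨ l.val + 1 < k.val) :
    sHecke k * sHecke l = sHecke l * sHecke k := by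
  simpa [sHecke, uHecke] using mkAlgHom_eq (HeckeRel.s_comm k l h)

theorem sHecke_mul_uHecke_lo (k : Fin (m - 1)) :
    sHecke k * uHecke (lo k) = uHecke (hi k) * sHecke k + 1 := by
  simpa [sHecke, uHecke] using mkAlgHom_eq (HeckeRel.s_u k)

theorem sHecke_mul_uHecke (k : Fin (m - 1)) (l : Fin m) (h : l ≠ lo k) (h' : l ≠ hi k) :
    sHecke k * uHecke l = uHecke l * sHecke k := by
  simpa [sHecke, uHecke] using mkAlgHom_eq (HeckeRel.s_u_comm k l h h')

theorem uHecke_comm (k l : Fin m) : uHecke k * uHecke l = uHecke l * uHecke k := by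
  simpa [sHecke, uHecke] using mkAlgHom_eq (HeckeRel.u_comm k l)

/-- Multiply the relation for `s_k u_k` by `s_k` on both sides. -/
theorem sHecke_mul_uHecke_hi (k : Fin (m - 1)) :
    sHecke k * uHecke (hi k) = uHecke (lo k) * sHecke k - 1 := by
  have h := congrArg (fun x => sHecke k * x * sHecke k) (sHecke_mul_uHecke_lo k)
  simp only [mul_add, add_mul, mul_one, sHecke_sq] at h
  rw [← mul_assoc, sHecke_sq, one_mul, mul_assoc, mul_assoc, sHecke_sq, mul_one] at h
  rw [h, add_sub_cancel_right]

/-- `s_k u_l` is `u_{l'} s_k` up to a scalar. -/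
theorem exists_sHecke_mul_uHecke (k : Fin (m - 1)) (l : Fin m) :
    ∃ (l' : Fin m) (c : ℂ), sHecke k * uHecke l = uHecke l' * sHecke k + algebraMap ℂ _ c := by
  by_cases h : l = lo k
  · subst h
    exact ⟨hi k, 1, by rw [sHecke_mul_uHecke_lo, map_one]⟩
  by_cases h' : l = hi k
  · subst h'
    exact ⟨lo k, -1, by rw [sHecke_mul_uHecke_hi, map_neg, map_one, sub_eq_add_neg]⟩
  · exact ⟨l, 0, by rw [sHecke_mul_uHecke k l h h', map_zero, add_zero]⟩

/-- A linear subspace of `H_m` that contains `1` and is closed under left multiplication by the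
generators is everything. -/
theorem mem_of_mul_mem (V : Submodule ℂ (Hecke m)) (h1 : 1 ∈ V)
    (hs : ∀ k, ∀ x ∈ V, sHecke k * x ∈ V) (hu : ∀ k, ∀ x ∈ V, uHecke k * x ∈ V) (x : Hecke m) :
    x ∈ V := by
  obtain ⟨a, rfl⟩ := RingQuot.mkAlgHom_surjective ℂ (HeckeRel m) x
  have key : ∀ x ∈ V, RingQuot.mkAlgHom ℂ (HeckeRel m) a * x ∈ V := by
    induction a using FreeAlgebra.induction with
    | grade0 r =>
      intro x hx
      rw [AlgHom.commutes, ← Algebra.smul_def]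
      exact V.smul_mem r hx
    | grade1 i =>
      rcases i with k | k
      · exact hs k
      · exact hu k
    | mul a b ha hb =>
      intro x hx
      rw [map_mul, mul_assoc]
      exact ha _ (hb x hx)
    | add a b ha hb =>
      intro x hx
      rw [map_add, add_mul]
      exact V.add_mem (ha x hx) (hb x hx)
  simpa using key 1 h1

-- Evaluation of polynomials needs a commutative target, so it is done in the subalgebra generated
-- by the commuting `u_k`.
open scoped IsMulCommutative in
theorem exists_polyHecke (m : ℕ) : ∃ p : MvPolynomial (Fin m) ℂ →ₐ[ℂ] Hecke m,
    ∀ k, p (MvPolynomial.X k) = uHecke k := by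
  have := Algebra.isMulCommutative_adjoin ℂ (s := Set.range (uHecke (m := m))) (by
    rintro _ ⟨k, rfl⟩ _ ⟨l, rfl⟩
    exact uHecke_comm k l)
  let u : Fin m → Algebra.adjoin ℂ (Set.range (uHecke (m := m))) := fun k =>
    ⟨uHecke k, Algebra.subset_adjoin ⟨k, rfl⟩⟩
  refine ⟨(Algebra.adjoin ℂ (Set.range (uHecke (m := m)))).val.comp
    (MvPolynomial.aeval u), fun k => ?_⟩
  simp [u]

/-- The polynomials in `u_1, …, u_m` in `H_m`. -/
def polyHecke (m : ℕ) : MvPolynomial (Fin m) ℂ →ₐ[ℂ] Hecke m := (exists_polyHecke m).choose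

theorem polyHecke_X (k : Fin m) : polyHecke m (MvPolynomial.X k) = uHecke k :=
  (exists_polyHecke m).choose_spec k

/-- The permutations in `H_m`. -/
def permHecke (m : ℕ) : Equiv.Perm (Fin m) →* Hecke m :=
  (exists_hom_perm sHecke sHecke_sq sHecke_braid sHecke_comm).choose

theorem permHecke_adjSwap (k : Fin (m - 1)) : permHecke m (adjSwap k) = sHecke k :=
  (exists_hom_perm sHecke sHecke_sq sHecke_braid sHecke_comm).choose_spec k

/-- Moves `s_k` to the right of a polynomial, one variable at a time. The exact form of `g` and `h`
is irrelevant for a spanning argument. -/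
theorem exists_sHecke_mul_polyHecke (k : Fin (m - 1)) (f : MvPolynomial (Fin m) ℂ) :
    ∃ g h, sHecke k * polyHecke m f = polyHecke m g * sHecke k + polyHecke m h := by
  induction f using MvPolynomial.induction_on with
  | C r =>
    refine ⟨MvPolynomial.C r, 0, ?_⟩
    rw [map_zero, add_zero, ← MvPolynomial.algebraMap_eq, AlgHom.commutes, Algebra.commutes]
  | add f f' hf hf' =>
    obtain ⟨g, h, e⟩ := hf
    obtain ⟨g', h', e'⟩ := hf'
    refine ⟨g + g', h + h', ?_⟩
    simp only [map_add, mul_add, add_mul, e, e']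
    abel
  | mul_X f l hf =>
    obtain ⟨g, h, e⟩ := hf
    obtain ⟨l', c, e'⟩ := exists_sHecke_mul_uHecke k l
    refine ⟨g * MvPolynomial.X l', g * MvPolynomial.C c + h * MvPolynomial.X l, ?_⟩
    rw [← MvPolynomial.algebraMap_eq]
    simp only [map_add, map_mul, polyHecke_X, AlgHom.commutes]
    rw [← mul_assoc, e, add_mul, mul_assoc _ (sHecke k), e']
    simp only [mul_add, mul_assoc, add_assoc]

/-- The linear combination `∑ f_w w` with polynomial coefficients `f_w`. -/
def pbw (m : ℕ) : (Equiv.Perm (Fin m) → MvPolynomial (Fin m) ℂ) →ₗ[ℂ] Hecke m :=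
  ∑ w, (LinearMap.mulRight ℂ (permHecke m w)).comp
    ((polyHecke m).toLinearMap.comp (LinearMap.proj w))

theorem pbw_apply (f : Equiv.Perm (Fin m) → MvPolynomial (Fin m) ℂ) :
    pbw m f = ∑ w, polyHecke m (f w) * permHecke m w := by
  simp [pbw]

theorem poly_mul_perm_mem_range_pbw (f : MvPolynomial (Fin m) ℂ) (w : Equiv.Perm (Fin m)) :
    polyHecke m f * permHecke m w ∈ LinearMap.range (pbw m) := by
  classical
  refine ⟨Pi.single w f, ?_⟩
  rw [pbw_apply, Finset.sum_eq_single w]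
  · rw [Pi.single_eq_same]
  · intro v _ hv
    rw [Pi.single_eq_of_ne hv, map_zero, zero_mul]
  · simp

/-- Only the spanning half of the PBW theorem. Independence comes later, from the images in the
group algebras. -/
theorem pbw_surjective (m : ℕ) : Function.Surjective (pbw m) := by
  have h := mem_of_mul_mem (LinearMap.range (pbw m)) ?_ ?_ ?_
  · exact h
  · simpa using poly_mul_perm_mem_range_pbw 1 1
  · rintro k _ ⟨f, rfl⟩
    rw [pbw_apply, Finset.mul_sum]
    refine Submodule.sum_mem _ fun w _ => ?_
    obtain ⟨g, h, e⟩ := exists_sHecke_mul_polyHecke k (f w)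
    rw [← mul_assoc, e, add_mul, mul_assoc, ← permHecke_adjSwap, ← map_mul (permHecke m)]
    exact add_mem (poly_mul_perm_mem_range_pbw _ _) (poly_mul_perm_mem_range_pbw _ _)
  · rintro k _ ⟨f, rfl⟩
    rw [pbw_apply, Finset.mul_sum]
    refine Submodule.sum_mem _ fun w _ => ?_
    rw [← mul_assoc, ← polyHecke_X, ← map_mul (polyHecke m)]
    exact poly_mul_perm_mem_range_pbw _ _

end Relations

/-! ### Products of transpositions -/

section SwapProd

variable {α : Type*} [DecidableEq α]

/-- The product of the transpositions in a list. -/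
def swapProd (L : List (α × α)) : Equiv.Perm α := (L.map fun p => Equiv.swap p.1 p.2).prod

theorem swapProd_cons (p : α × α) (L : List (α × α)) :
    swapProd (p :: L) = Equiv.swap p.1 p.2 * swapProd L := by
  simp [swapProd]

theorem swapProd_apply_of_notMem {L : List (α × α)} {x : α} (h : x ∉ L.map Prod.fst)
    (h' : x ∉ L.map Prod.snd) : swapProd L x = x := by
  induction L with
  | nil => rfl
  | cons p L ih =>
    rw [List.map_cons, List.mem_cons, not_or] at h h'
    rw [swapProd_cons, Equiv.Perm.mul_apply, ih h.2 h'.2, Equiv.swap_apply_of_ne_of_ne h.1 h'.1]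

theorem apply_swap_of_eq {β : Type*} {c : α → β} {a b : α} (h : c b = c a) (x : α) :
    c (Equiv.swap a b x) = c x := by
  rw [Equiv.swap_apply_def]
  split_ifs with h1 h2
  · rw [h1, h]
  · rw [h2, h]
  · rfl

theorem apply_swapProd {β : Type*} {c : α → β} {L : List (α × α)}
    (h : ∀ p ∈ L, c p.2 = c p.1) (x : α) : c (swapProd L x) = c x := by
  induction L with
  | nil => rfl
  | cons p L ih =>
    rw [swapProd_cons, Equiv.Perm.mul_apply, apply_swap_of_eq (h p (by simp)),
      ih fun q hq => h q (by simp [hq])]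

/-- If the product of transpositions `(l i)` with distinct `i` preserves the colours of the points
`i`, then each `l` has the colour of its `i`. -/
theorem colour_eq_of_swapProd {β : Type*} {c : α → β} {L : List (α × α)}
    (hn : (L.map Prod.snd).Nodup) (hd : ∀ p ∈ L, p.2 ∉ L.map Prod.fst)
    (hc : ∀ p ∈ L, c (swapProd L p.2) = c p.2) : ∀ p ∈ L, c p.2 = c p.1 := by
  induction L with
  | nil => simp
  | cons q L ih =>
    have hd' : ∀ p ∈ q :: L, p.2 ∉ L.map Prod.fst := fun p hp h =>
      hd p hp (by rw [List.map_cons]; exact List.mem_cons_of_mem _ h)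
    rw [List.map_cons, List.nodup_cons] at hn
    -- No later pair of the list involves `q.2`, so the whole product sends it to `q.1`.
    have hq : c q.2 = c q.1 := by
      have := hc q (by simp)
      rw [swapProd_cons, Equiv.Perm.mul_apply,
        swapProd_apply_of_notMem (hd' q (by simp)) hn.1, Equiv.swap_apply_right] at this
      exact this.symm
    intro p hp
    rcases List.mem_cons.1 hp with rfl | hp
    · exact hq
    · refine ih hn.2 (fun p hp => hd' p (by simp [hp])) (fun p hp => ?_) p hp
      -- As `q.1` and `q.2` have the same colour, their transposition does not affect colours and
      -- can be dropped.
      have := hc p (by simp [hp])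
      rwa [swapProd_cons, Equiv.Perm.mul_apply, apply_swap_of_eq hq] at this

/-- Its own transposition takes `p.2` away, and no other transposition in the list involves `p.2`,
so nothing can bring it back. -/
theorem swapProd_apply_ne {L : List (α × α)} (hn : (L.map Prod.snd).Nodup)
    (hd : ∀ p ∈ L, p.2 ∉ L.map Prod.fst) : ∀ p ∈ L, swapProd L p.2 ≠ p.2 := by
  induction L with
  | nil => simp
  | cons q L ih =>
    have hd' : ∀ p ∈ q :: L, p.2 ≠ q.1 ∧ p.2 ∉ L.map Prod.fst := fun p hp => by
      simpa only [List.map_cons, List.mem_cons, not_or] using hd p hp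
    rw [List.map_cons, List.nodup_cons] at hn
    intro p hp
    rcases List.mem_cons.1 hp with rfl | hp
    · rw [swapProd_cons, Equiv.Perm.mul_apply,
        swapProd_apply_of_notMem (hd' p (by simp)).2 hn.1, Equiv.swap_apply_right]
      exact (hd' p (by simp)).1.symm
    · have hne : p.2 ≠ q.2 := fun h => hn.1 (h ▸ List.mem_map_of_mem hp)
      rw [swapProd_cons, Equiv.Perm.mul_apply]
      intro h
      rw [Equiv.swap_apply_eq_iff,
        Equiv.swap_apply_of_ne_of_ne (hd' p (by simp [hp])).1 hne] at h
      exact ih hn.2 (fun p hp => (hd' p (by simp [hp])).2) p hp h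

/-- The colour of a point is the head to which it is attached; distinctness of the second entries
makes this well defined. -/
theorem exists_colouring {L : List (α × α)} (hn : (L.map Prod.snd).Nodup) :
    ∃ c : α → α, (∀ p ∈ L, c p.2 = p.1) ∧ ∀ x, x ∉ L.map Prod.snd → c x = x := by
  induction L with
  | nil => exact ⟨id, by simp⟩
  | cons q L ih =>
    rw [List.map_cons, List.nodup_cons] at hn
    obtain ⟨c, h1, h2⟩ := ih hn.2
    refine ⟨Function.update c q.2 q.1, fun p hp => ?_, fun x hx => ?_⟩
    · rcases List.mem_cons.1 hp with rfl | hp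
      · simp
      · have hne : p.2 ≠ q.2 := fun h => hn.1 (h ▸ List.mem_map_of_mem hp)
        rw [Function.update_of_ne hne, h1 p hp]
    · rw [List.map_cons, List.mem_cons, not_or] at hx
      rw [Function.update_of_ne hx.1, h2 x hx.2]

theorem apply_mem_of_fix {β : Type*} {H : β → Prop} {v : Equiv.Perm β}
    (hv : ∀ x, ¬ H x → v x = x) {x : β} (hx : H x) : H (v x) := by
  by_contra h
  rw [v.injective (hv _ h)] at h
  exact h hx

/-- A product of transpositions `(l i)`, `l ∈ H`, with distinct `i ∉ H` determines the `l`, among the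
products of at most as many transpositions and up to permutations of `H`. -/
theorem perm_of_swapProd_mul_eq {H : α → Prop} {L L₀ : List (α × α)} {v w : Equiv.Perm α}
    (hn : (L₀.map Prod.snd).Nodup) (h₁ : ∀ p ∈ L₀, H p.1) (h₂ : ∀ p ∈ L₀, ¬ H p.2)
    (hL : ∀ p ∈ L, H p.1) (hle : L.length ≤ L₀.length) (hv : ∀ x, ¬ H x → v x = x)
    (hw : ∀ x, ¬ H x → w x = x) (h : swapProd L * v = swapProd L₀ * w) :
    (L.map Prod.fst).Perm (L₀.map Prod.fst) ∧ v = w := by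
  have heads : ∀ {M : List (α × α)}, (∀ p ∈ M, H p.1) → ∀ x, ¬ H x → x ∉ M.map Prod.fst := by
    intro M hM x hx hmem
    obtain ⟨p, hp, rfl⟩ := List.mem_map.1 hmem
    exact hx (hM p hp)
  have tails : ∀ x ∈ L₀.map Prod.snd, ¬ H x := by
    intro x hx
    obtain ⟨p, hp, rfl⟩ := List.mem_map.1 hx
    exact h₂ p hp
  have happ : ∀ x, swapProd L (v x) = swapProd L₀ (w x) := fun x => by
    rw [← Equiv.Perm.mul_apply, h, Equiv.Perm.mul_apply]
  have happ' : ∀ x, ¬ H x → swapProd L x = swapProd L₀ x := fun x hx => by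
    have := happ x
    rwa [hv x hx, hw x hx] at this
  have hd₀ : ∀ p ∈ L₀, p.2 ∉ L₀.map Prod.fst := fun p hp => heads h₁ _ (h₂ p hp)
  -- Each second entry of `L₀` is moved by its product, hence by that of `L`; being outside `H`, it
  -- must be a second entry of `L`.
  have hsub : (L₀.map Prod.snd).toFinset ⊆ (L.map Prod.snd).toFinset := by
    intro x hx
    rw [List.mem_toFinset] at hx ⊢
    have hH := tails x hx
    obtain ⟨p, hp, rfl⟩ := List.mem_map.1 hx
    by_contra hcon
    apply swapProd_apply_ne hn hd₀ p hp
    rw [← happ' _ hH, swapProd_apply_of_notMem (heads hL _ hH) hcon]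
  have hcard₀ := List.toFinset_card_of_nodup hn
  have hcard := List.toFinset_card_le (L.map Prod.snd)
  have hle' := Finset.card_le_card hsub
  rw [List.length_map] at hcard₀ hcard
  -- The length bound now forces the second entries of `L` to be distinct and the same as those of
  -- `L₀`.
  have heq := Finset.eq_of_subset_of_card_le hsub (by omega)
  have hnL : (L.map Prod.snd).Nodup := by
    rw [← Multiset.coe_nodup, ← Multiset.toFinset_card_eq_card_iff_nodup]
    change (L.map Prod.snd).toFinset.card = (L.map Prod.snd).length
    rw [List.length_map]
    omega
  have hperm : (L.map Prod.snd).Perm (L₀.map Prod.snd) :=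
    List.perm_of_nodup_nodup_toFinset_eq hnL hn heq.symm
  have tailsL : ∀ p ∈ L, ¬ H p.2 := fun p hp =>
    tails _ (hperm.mem_iff.1 (List.mem_map_of_mem hp))
  -- The colouring is adapted to `L₀`, but the product of `L` agrees with that of `L₀` outside `H`,
  -- so `L` respects it too. Heads can then be read off as colours of second entries.
  obtain ⟨c, hc, hc'⟩ := exists_colouring hn
  have hcH : ∀ x, H x → c x = x := fun x hx => hc' x fun hmem => tails x hmem hx
  have hc₀ : ∀ x, c (swapProd L₀ x) = c x := apply_swapProd fun p hp => by
    rw [hc p hp, hcH _ (h₁ p hp)]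
  have hcL : ∀ p ∈ L, c p.2 = c p.1 :=
    colour_eq_of_swapProd hnL (fun p hp => heads hL _ (tailsL p hp)) fun p hp => by
      rw [happ' _ (tailsL p hp), hc₀]
  constructor
  · have e : L.map Prod.fst = (L.map Prod.snd).map c := by
      rw [List.map_map]
      exact List.map_congr_left fun p hp => by
        rw [Function.comp_apply, hcL p hp, hcH _ (hL p hp)]
    have e₀ : L₀.map Prod.fst = (L₀.map Prod.snd).map c := by
      rw [List.map_map]
      exact List.map_congr_left fun p hp => (hc p hp).symm
    rw [e, e₀]
    exact hperm.map c
  · ext1 x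
    by_cases hx : H x
    · have := congrArg c (happ x)
      rwa [apply_swapProd hcL, hc₀, hcH _ (apply_mem_of_fix hv hx),
        hcH _ (apply_mem_of_fix hw hx)] at this
    · rw [hv x hx, hw x hx]

end SwapProd

/-! ### Jucys–Murphy elements -/

/-- The group algebra of the symmetric group. -/
abbrev GAlg (n : ℕ) : Type := MonoidAlgebra ℂ (Equiv.Perm (Fin n))

/-- The Jucys–Murphy element `∑_{i > k} (k i)`. -/
def jucys {n : ℕ} (k : Fin n) : GAlg n :=
  ∑ i ∈ Finset.univ.filter (fun i => k < i), MonoidAlgebra.of ℂ _ (Equiv.swap k i)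

/-- The number of ways to write `σ` as a product of transpositions `(l i)`, `i > l`, where `l` runs
through the list `ls`. -/
def swapCount {n : ℕ} : List (Fin n) → Equiv.Perm (Fin n) → ℕ
  | [], σ => if σ = 1 then 1 else 0
  | k :: ls, σ => ∑ i ∈ Finset.univ.filter (fun i => k < i), swapCount ls (Equiv.swap k i * σ)

/-- The coefficients are natural numbers: within one monomial in Jucys–Murphy elements nothing
cancels. -/
theorem coeff_prod_jucys {n : ℕ} (ls : List (Fin n)) (σ : Equiv.Perm (Fin n)) :
    ((ls.map jucys).prod : GAlg n).coeff σ = swapCount ls σ := by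
  induction ls generalizing σ with
  | nil =>
    simp [swapCount, MonoidAlgebra.one_def, Finsupp.single_apply, eq_comm]
  | cons k ls ih =>
    simp [swapCount, jucys, Finset.sum_mul, MonoidAlgebra.coeff_single_mul_apply, ih]

theorem swapCount_ne_zero_iff {n : ℕ} (ls : List (Fin n)) (σ : Equiv.Perm (Fin n)) :
    swapCount ls σ ≠ 0 ↔
      ∃ L : List (Fin n × Fin n), L.map Prod.fst = ls ∧ (∀ p ∈ L, p.1 < p.2) ∧ swapProd L = σ := by
  induction ls generalizing σ with
  | nil =>
    simp only [swapCount, ne_eq, ite_eq_right_iff, one_ne_zero, imp_false, not_not,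
      List.map_eq_nil_iff]
    exact ⟨fun h => ⟨[], rfl, by simp, h.symm⟩, by rintro ⟨_, rfl, _, rfl⟩; rfl⟩
  | cons k ls ih =>
    simp only [swapCount, ne_eq, Finset.sum_eq_zero_iff, Finset.mem_filter, Finset.mem_univ,
      true_and, not_forall]
    constructor
    · rintro ⟨i, hi, h⟩
      obtain ⟨L, h1, h2, h3⟩ := (ih _).1 h
      refine ⟨(k, i) :: L, by simp [h1], ?_, ?_⟩
      · rintro p (_ | ⟨_, hp⟩)
        exacts [hi, h2 p hp]
      · rw [swapProd_cons, h3, ← mul_assoc, Equiv.swap_mul_self, one_mul]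
    · rintro ⟨_ | ⟨⟨l, i⟩, L⟩, h1, h2, h3⟩
      · simp at h1
      · rw [List.map_cons, List.cons.injEq] at h1
        obtain ⟨rfl, h1⟩ := h1
        refine ⟨i, h2 (l, i) (by simp), (ih _).2 ⟨L, h1, fun p hp => h2 p (by simp [hp]), ?_⟩⟩
        rw [← h3, swapProd_cons, ← mul_assoc, Equiv.swap_mul_self, one_mul]

/-- Conjugation by `τ` permutes the summands. -/
theorem of_mul_jucys {n : ℕ} {τ : Equiv.Perm (Fin n)} {k : Fin n} (hk : τ k = k)
    (h : ∀ i, k < i ↔ k < τ i) :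
    MonoidAlgebra.of ℂ _ τ * jucys k = jucys k * MonoidAlgebra.of ℂ _ τ := by
  rw [jucys, Finset.mul_sum, Finset.sum_mul]
  refine Finset.sum_equiv τ (fun i => by simp [h i]) fun i _ => ?_
  rw [← map_mul, ← map_mul, Equiv.mul_swap_eq_swap_mul, hk]

/-- The summand `(a b)` of `jucys a` yields the `1`; conjugation by `(a b)` turns the others, `(a
i)` with `i > b`, into the summands of `jucys b`. -/
theorem of_swap_mul_jucys {n : ℕ} {a b : Fin n} (h : b.val = a.val + 1) :
    MonoidAlgebra.of ℂ _ (Equiv.swap a b) * jucys a =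
      jucys b * MonoidAlgebra.of ℂ _ (Equiv.swap a b) + 1 := by
  have e : Finset.univ.filter (fun i => a < i) =
      insert b (Finset.univ.filter fun i => b < i) := by
    ext i
    simp only [Finset.mem_filter, Finset.mem_univ, true_and, Finset.mem_insert, Fin.lt_def,
      Fin.ext_iff]
    omega
  rw [jucys, e, Finset.sum_insert (by simp), mul_add, ← map_mul, Equiv.swap_mul_self, map_one,
    add_comm, jucys, Finset.mul_sum, Finset.sum_mul]
  congr 1
  refine Finset.sum_congr rfl fun i hi => ?_
  have hi : b < i := by simpa using hi
  have h1 : i ≠ b := hi.ne'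
  have h2 : i ≠ a := by
    rintro rfl
    have := Fin.lt_def.1 hi
    omega
  rw [← map_mul, ← map_mul, Equiv.mul_swap_eq_swap_mul, Equiv.swap_apply_left,
    Equiv.swap_apply_of_ne_of_ne h2 h1]

theorem of_swap_comm_jucys {n : ℕ} {a b k : Fin n} (h : a < k ∧ b < k ∨ k < a ∧ k < b) :
    MonoidAlgebra.of ℂ _ (Equiv.swap a b) * jucys k =
      jucys k * MonoidAlgebra.of ℂ _ (Equiv.swap a b) := by
  refine of_mul_jucys (Equiv.swap_apply_of_ne_of_ne ?_ ?_) fun i => ?_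
  · rintro rfl
    simp at h
  · rintro rfl
    simp at h
  · rw [Equiv.swap_apply_def]
    simp only [Fin.lt_def] at h
    split_ifs with h1 h2
    · subst h1
      simp only [Fin.lt_def]
      omega
    · subst h2
      simp only [Fin.lt_def]
      omega
    · rfl

/-- For `k < l`, every summand of `jucys l` transposes two points above `k`, so it commutes with
`jucys k`. -/
theorem jucys_comm {n : ℕ} (k l : Fin n) : jucys k * jucys l = jucys l * jucys k := by
  have key : ∀ k l : Fin n, k < l → jucys k * jucys l = jucys l * jucys k := by
    intro k l h
    conv_lhs => rw [jucys.eq_1 l, Finset.mul_sum]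
    conv_rhs => rw [jucys.eq_1 l, Finset.sum_mul]
    refine Finset.sum_congr rfl fun i hi => ?_
    have hi : l < i := by simpa using hi
    exact (of_swap_comm_jucys (.inr ⟨h, h.trans hi⟩)).symm
  rcases lt_trichotomy k l with h | rfl | h
  · exact key k l h
  · rfl
  · exact (key l k h).symm

/-- The inclusion of symmetric groups. -/
def inclPerm {m n : ℕ} (h : m ≤ n) : Equiv.Perm (Fin m) →* Equiv.Perm (Fin n) :=
  Equiv.Perm.viaEmbeddingHom (Fin.castLEEmb h)

theorem inclPerm_apply {m n : ℕ} (h : m ≤ n) (w : Equiv.Perm (Fin m)) (x : Fin m) :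
    inclPerm h w (Fin.castLE h x) = Fin.castLE h (w x) :=
  Equiv.Perm.viaEmbedding_apply w (Fin.castLEEmb h) x

theorem inclPerm_apply_of_le {m n : ℕ} (h : m ≤ n) (w : Equiv.Perm (Fin m)) {x : Fin n}
    (hx : ¬ x.val < m) : inclPerm h w x = x := by
  refine Equiv.Perm.viaEmbedding_apply_of_notMem w (Fin.castLEEmb h) x ?_
  rintro ⟨y, rfl⟩
  exact hx y.2

theorem inclPerm_injective {m n : ℕ} (h : m ≤ n) : Function.Injective (inclPerm h) :=
  Equiv.Perm.viaEmbeddingHom_injective _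

theorem inclPerm_swap {m n : ℕ} (h : m ≤ n) (a b : Fin m) :
    inclPerm h (Equiv.swap a b) = Equiv.swap (Fin.castLE h a) (Fin.castLE h b) := by
  ext1 x
  by_cases hx : x.val < m
  · obtain ⟨y, rfl⟩ : ∃ y, Fin.castLE h y = x := ⟨⟨x.val, hx⟩, rfl⟩
    rw [inclPerm_apply]
    exact ((Fin.castLEEmb h).injective.swap_apply a b _).symm
  · rw [inclPerm_apply_of_le h _ hx, Equiv.swap_apply_of_ne_of_ne]
    · rintro rfl
      exact hx a.2
    · rintro rfl
      exact hx b.2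

/-! ### Representations of `H_m` by Jucys–Murphy elements -/

/-- The images in `ℂ[S_n]` of the generators of `H_m`. -/
def groupGen {m n : ℕ} (h : m ≤ n) : Fin (m - 1) ⊕ Fin m → GAlg n :=
  Sum.elim (fun k => MonoidAlgebra.of ℂ _ (inclPerm h (adjSwap k))) fun k => jucys (Fin.castLE h k)

theorem lift_groupGen_fs {m n : ℕ} (h : m ≤ n) (k : Fin (m - 1)) :
    FreeAlgebra.lift ℂ (groupGen h) (fs k) = MonoidAlgebra.of ℂ _ (inclPerm h (adjSwap k)) :=
  FreeAlgebra.lift_ι_apply _ _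

theorem lift_groupGen_fu {m n : ℕ} (h : m ≤ n) (k : Fin m) :
    FreeAlgebra.lift ℂ (groupGen h) (fu k) = jucys (Fin.castLE h k) :=
  FreeAlgebra.lift_ι_apply _ _

/-- The homomorphism `H_m → ℂ[S_n]` that sends the `u_k` to Jucys–Murphy elements. -/
def toGAlg {m n : ℕ} (h : m ≤ n) : Hecke m →ₐ[ℂ] GAlg n :=
  RingQuot.liftAlgHom ℂ ⟨FreeAlgebra.lift ℂ (groupGen h), by
    intro x y hxy
    induction hxy with
    | s_sq k =>
      rw [map_mul, lift_groupGen_fs, ← map_mul, ← map_mul, adjSwap_sq, map_one, map_one, map_one]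
    | braid k l hkl =>
      simp only [map_mul, lift_groupGen_fs]
      simp only [← map_mul, adjSwap_braid k l hkl]
    | s_comm k l hkl =>
      simp only [map_mul, lift_groupGen_fs]
      simp only [← map_mul, adjSwap_comm k l hkl]
    | s_u k =>
      simp only [map_mul, map_add, map_one, lift_groupGen_fs, lift_groupGen_fu, adjSwap,
        inclPerm_swap]
      exact of_swap_mul_jucys rfl
    | s_u_comm k l h₁ h₂ =>
      simp only [map_mul, lift_groupGen_fs, lift_groupGen_fu, adjSwap, inclPerm_swap]
      -- The adjacent points `k` and `k + 1` lie on the same side of `l`.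
      apply of_swap_comm_jucys
      simp only [ne_eq, Fin.ext_iff, Fin.lt_def, Fin.val_castLE, lo, hi] at h₁ h₂ ⊢
      omega
    | u_comm k l =>
      simp only [map_mul, lift_groupGen_fu]
      exact jucys_comm _ _⟩

theorem toGAlg_sHecke {m n : ℕ} (h : m ≤ n) (k : Fin (m - 1)) :
    toGAlg h (sHecke k) = MonoidAlgebra.of ℂ _ (inclPerm h (adjSwap k)) := by
  rw [toGAlg, sHecke, RingQuot.liftAlgHom_mkAlgHom_apply, lift_groupGen_fs]

theorem toGAlg_uHecke {m n : ℕ} (h : m ≤ n) (k : Fin m) :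
    toGAlg h (uHecke k) = jucys (Fin.castLE h k) := by
  rw [toGAlg, uHecke, RingQuot.liftAlgHom_mkAlgHom_apply, lift_groupGen_fu]

theorem toGAlg_permHecke {m n : ℕ} (h : m ≤ n) (w : Equiv.Perm (Fin m)) :
    toGAlg h (permHecke m w) = MonoidAlgebra.of ℂ _ (inclPerm h w) := by
  have : (toGAlg h : Hecke m →* GAlg n).comp (permHecke m) =
      (MonoidAlgebra.of ℂ _).comp (inclPerm h) := by
    refine MonoidHom.eq_of_eqOn_denseM (closure_adjSwap m) ?_
    rintro _ ⟨k, rfl⟩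
    simp only [MonoidHom.comp_apply, permHecke_adjSwap]
    exact toGAlg_sHecke h k
  exact DFunLike.congr_fun this w

/-! ### Joint faithfulness of these representations -/

theorem monomial_eq_list_prod {m : ℕ} (b : Fin m →₀ ℕ) :
    (MvPolynomial.monomial b 1 : MvPolynomial (Fin m) ℂ) =
      (b.toMultiset.toList.map MvPolynomial.X).prod := by
  rw [← Multiset.prod_coe, ← Multiset.map_coe, Multiset.coe_toList, MvPolynomial.monomial_eq,
    map_one, one_mul, Finsupp.toMultiset_map, Finsupp.prod_toMultiset, Finsupp.prod_mapDomain_index]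
  · intro; simp
  · intros; rw [pow_add]

theorem toGAlg_polyHecke {m n : ℕ} (h : m ≤ n) (f : MvPolynomial (Fin m) ℂ) :
    toGAlg h (polyHecke m f) = ∑ b ∈ f.support, f.coeff b •
      ((b.toMultiset.toList.map (Fin.castLE h)).map jucys).prod := by
  conv_lhs => rw [f.as_sum, map_sum, map_sum]
  refine Finset.sum_congr rfl fun b _ => ?_
  rw [← mul_one (f.coeff b), ← smul_eq_mul, ← MvPolynomial.smul_monomial, map_smul, map_smul,
    monomial_eq_list_prod, map_list_prod, map_list_prod, List.map_map, List.map_map, List.map_map,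
    smul_eq_mul, mul_one]
  congr 3
  funext k
  simp [polyHecke_X, toGAlg_uHecke]

theorem coeff_toGAlg_pbw {m n : ℕ} (h : m ≤ n) (f : Equiv.Perm (Fin m) → MvPolynomial (Fin m) ℂ)
    (σ : Equiv.Perm (Fin n)) :
    (toGAlg h (pbw m f)).coeff σ = ∑ v, ∑ b ∈ (f v).support, (f v).coeff b *
      swapCount (b.toMultiset.toList.map (Fin.castLE h)) (σ * (inclPerm h v)⁻¹) := by
  rw [pbw_apply, map_sum, MonoidAlgebra.coeff_sum, Finsupp.finsetSum_apply]
  refine Finset.sum_congr rfl fun v _ => ?_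
  rw [map_mul, toGAlg_permHecke, MonoidAlgebra.of_apply, MonoidAlgebra.coeff_mul_single_apply,
    mul_one, toGAlg_polyHecke, MonoidAlgebra.coeff_sum, Finsupp.finsetSum_apply]
  refine Finset.sum_congr rfl fun b _ => ?_
  rw [MonoidAlgebra.coeff_smul_apply, coeff_prod_jucys, smul_eq_mul]

/-- All `d` are needed: the symmetric group in which `f` is detected grows with the degree of `f`.
-/
theorem eq_zero_of_toGAlg_pbw {m : ℕ} {f : Equiv.Perm (Fin m) → MvPolynomial (Fin m) ℂ}
    (hf : ∀ d, toGAlg (Nat.le_add_right m d) (pbw m f) = 0) : f = 0 := by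
  classical
  by_contra hne
  let I : Finset (Σ _ : Equiv.Perm (Fin m), Fin m →₀ ℕ) := Finset.univ.sigma fun v => (f v).support
  have hI : I.Nonempty := by
    obtain ⟨w, hw⟩ := Function.ne_iff.1 hne
    obtain ⟨b, hb⟩ := MvPolynomial.support_nonempty.2 hw
    exact ⟨⟨w, b⟩, Finset.mem_sigma.2 ⟨Finset.mem_univ _, hb⟩⟩
  obtain ⟨⟨w, a⟩, hwa, hmax⟩ :=
    I.exists_max_image (fun p => Multiset.card p.2.toMultiset) hI
  have ha : a ∈ (f w).support := (Finset.mem_sigma.1 hwa).2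
  obtain ⟨d, hd⟩ : ∃ d, Multiset.card a.toMultiset = d := ⟨_, rfl⟩
  have h := Nat.le_add_right m d
  let ls : List (Fin (m + d)) := a.toMultiset.toList.map (Fin.castLE h)
  -- The `d` variables of the top monomial, with multiplicity, are paired with the `d` points that
  -- `S_{m+d}` has beyond the first `m`.
  let L₀ : List (Fin (m + d) × Fin (m + d)) := ls.zip ((List.finRange d).map (Fin.natAdd m))
  have hlen : ls.length = ((List.finRange d).map (Fin.natAdd m)).length := by simp [ls, hd]
  have hfst : L₀.map Prod.fst = ls := List.map_fst_zip hlen.le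
  have hsnd : L₀.map Prod.snd = (List.finRange d).map (Fin.natAdd m) := List.map_snd_zip hlen.ge
  have hL₀ : L₀.length = d := by rw [← List.length_map (f := Prod.snd), hsnd]; simp
  have h₁ : ∀ p ∈ L₀, p.1.val < m := by
    intro p hp
    have := List.mem_map_of_mem (f := Prod.fst) hp
    rw [hfst] at this
    obtain ⟨k, _, hk⟩ := List.mem_map.1 this
    rw [← hk]
    exact k.2
  have h₂ : ∀ p ∈ L₀, ¬ p.2.val < m := by
    intro p hp
    have := List.mem_map_of_mem (f := Prod.snd) hp
    rw [hsnd] at this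
    obtain ⟨k, _, hk⟩ := List.mem_map.1 this
    rw [← hk]
    simp
  have hn : (L₀.map Prod.snd).Nodup := by
    rw [hsnd]
    exact (List.nodup_finRange d).map (Fin.natAdd_injective d m)
  have key := coeff_toGAlg_pbw h f (swapProd L₀ * inclPerm h w)
  -- Maximality of `d` bounds the number of transpositions from `b`, so a nonzero count would force
  -- `b = a` and `v = w`.
  have hzero : ∀ v b, b ∈ (f v).support → (v, b) ≠ (w, a) →
      swapCount (b.toMultiset.toList.map (Fin.castLE h))
        (swapProd L₀ * inclPerm h w * (inclPerm h v)⁻¹) = 0 := by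
    intro v b hb hvb
    by_contra hcon
    obtain ⟨L, hL, _, hprod⟩ := (swapCount_ne_zero_iff _ _).1 hcon
    have hbd : Multiset.card b.toMultiset ≤ d := hd ▸ hmax ⟨v, b⟩ (by simp [I, hb])
    obtain ⟨hperm, hvw⟩ := perm_of_swapProd_mul_eq (H := fun x : Fin (m + d) => x.val < m)
      (L := L) (v := inclPerm h v) (w := inclPerm h w) hn h₁ h₂
      (fun p hp => by
        have := List.mem_map_of_mem (f := Prod.fst) hp
        rw [hL] at this
        obtain ⟨k, _, hk⟩ := List.mem_map.1 this
        rw [← hk]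
        exact k.2)
      (by rw [hL₀, ← List.length_map (f := Prod.fst), hL]; simpa using hbd)
      (fun x hx => inclPerm_apply_of_le h v hx) (fun x hx => inclPerm_apply_of_le h w hx)
      (by rw [hprod, inv_mul_cancel_right])
    rw [hL, hfst, List.map_perm_map_iff (Fin.castLE_injective h), ← Multiset.coe_eq_coe,
      Multiset.coe_toList, Multiset.coe_toList] at hperm
    exact hvb (Prod.ext (inclPerm_injective h hvw) (Multiset.toFinsupp.symm.injective hperm))
  rw [hf d, Finset.sum_eq_single w, Finset.sum_eq_single a] at key
  · have hpos : swapCount ls (swapProd L₀ * inclPerm h w * (inclPerm h w)⁻¹) ≠ 0 :=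
      (swapCount_ne_zero_iff _ _).2 ⟨L₀, hfst, fun p hp => Fin.lt_def.2
        (lt_of_lt_of_le (h₁ p hp) (not_lt.1 (h₂ p hp))), by rw [mul_inv_cancel_right]⟩
    exact mul_ne_zero (MvPolynomial.mem_support_iff.1 ha) (Nat.cast_ne_zero.2 hpos) key.symm
  · intro b hb hba
    rw [hzero w b hb (fun e => hba (congrArg Prod.snd e)), Nat.cast_zero, mul_zero]
  · exact fun h => absurd ha h
  · intro v _ hvw
    refine Finset.sum_eq_zero fun b hb => ?_
    rw [hzero v b hb (fun e => hvw (congrArg Prod.fst e)), Nat.cast_zero, mul_zero]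
  · exact fun h => absurd (Finset.mem_univ w) h

/-- The homomorphism from `H_m` to the product of the group algebras of `S_n`, `n ≥ m`. -/
def heckeToGroups (m : ℕ) : Hecke m →ₐ[ℂ] ∀ j : ℕ, GAlg (m + j) :=
  AlgHom.pi fun j => toGAlg (Nat.le_add_right m j)

theorem heckeToGroups_injective (m : ℕ) : Function.Injective (heckeToGroups m) := by
  rw [injective_iff_map_eq_zero]
  intro x hx
  obtain ⟨f, rfl⟩ := pbw_surjective m x
  rw [eq_zero_of_toGAlg_pbw fun d => congrFun hx d, map_zero]

/-! ### From the semigroup algebra to the group algebra -/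

/-- Permutations as partial bijections. -/
def permHom (n : ℕ) : Equiv.Perm (Fin n) →* PBij n where
  toFun := Equiv.toPEquiv
  map_one' := Equiv.toPEquiv_refl
  map_mul' σ τ := Equiv.toPEquiv_trans τ σ

theorem permHom_apply {n : ℕ} (σ : Equiv.Perm (Fin n)) (x : Fin n) :
    permHom n σ x = some (σ x) := rfl

theorem permHom_injective (n : ℕ) : Function.Injective (permHom n) := fun _ _ h =>
  Equiv.ext fun x => Option.some.inj (DFunLike.congr_fun h x)

theorem exists_permHom_eq {n : ℕ} {γ : PBij n} (h : ∀ x, γ x ≠ none) : ∃ σ, permHom n σ = γ := by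
  choose f hf using fun x => Option.ne_none_iff_exists'.1 (h x)
  have hinj : Function.Injective f := fun x y hxy => γ.inj (hf x) (hxy ▸ hf y)
  refine ⟨Equiv.ofBijective f (Finite.injective_iff_bijective.1 hinj), ?_⟩
  ext1 x
  rw [permHom_apply, hf]
  rfl

/-- This is why killing all `ε_x` kills every partial bijection that is not total. -/
theorem mul_epsP_of_eq_none {n : ℕ} {γ : PBij n} {x : Fin n} (h : γ x = none) :
    γ * epsP x = γ := by
  ext1 y
  rw [mul_apply, epsP_apply]
  split_ifs with hy
  · rw [hy, h]
    rfl
  · rfl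

open scoped Classical in
/-- The multiplicative map that keeps the permutations and sends the other partial bijections to
`0`. -/
def totalPart (n : ℕ) : PBij n →* GAlg n where
  toFun γ := if h : ∃ σ, permHom n σ = γ then MonoidAlgebra.of ℂ _ h.choose else 0
  map_one' := by
    have h : ∃ σ, permHom n σ = 1 := ⟨1, map_one _⟩
    rw [dif_pos h, ← map_one (MonoidAlgebra.of ℂ (Equiv.Perm (Fin n)))]
    exact congrArg _ (permHom_injective n (h.choose_spec.trans (map_one _).symm))
  map_mul' f g := by
    by_cases hf : ∃ σ, permHom n σ = f
    · by_cases hg : ∃ σ, permHom n σ = g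
      · have h : ∃ σ, permHom n σ = f * g :=
          ⟨hf.choose * hg.choose, by rw [map_mul, hf.choose_spec, hg.choose_spec]⟩
        rw [dif_pos hf, dif_pos hg, dif_pos h, ← map_mul]
        exact congrArg _ (permHom_injective n
          (h.choose_spec.trans (by rw [map_mul, hf.choose_spec, hg.choose_spec])))
      · rw [dif_neg hg, mul_zero, dif_neg]
        rintro ⟨σ, hσ⟩
        refine hg (exists_permHom_eq fun x hx => ?_)
        have := DFunLike.congr_fun hσ x
        rw [mul_apply, hx] at this
        simp [permHom_apply] at this
    · rw [dif_neg hf, zero_mul, dif_neg]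
      rintro ⟨σ, hσ⟩
      by_cases hg : ∃ τ, permHom n τ = g
      · obtain ⟨τ, rfl⟩ := hg
        -- If the product and `g` are permutations, `f` is recovered as a quotient.
        refine hf ⟨σ * τ⁻¹, ?_⟩
        rw [map_mul, hσ, mul_assoc, ← map_mul, mul_inv_cancel, map_one, mul_one]
      · refine hg (exists_permHom_eq fun x hx => ?_)
        have := DFunLike.congr_fun hσ x
        rw [mul_apply, hx] at this
        simp [permHom_apply] at this

theorem totalPart_permHom {n : ℕ} (σ : Equiv.Perm (Fin n)) :
    totalPart n (permHom n σ) = MonoidAlgebra.of ℂ _ σ := by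
  have h : ∃ τ, permHom n τ = permHom n σ := ⟨σ, rfl⟩
  change dite _ _ _ = _
  rw [dif_pos h]
  exact congrArg _ (permHom_injective n h.choose_spec)

theorem totalPart_of_eq_none {n : ℕ} {γ : PBij n} {x : Fin n} (hx : γ x = none) :
    totalPart n γ = 0 := by
  change dite _ _ _ = _
  rw [dif_neg]
  rintro ⟨σ, rfl⟩
  simp [permHom_apply] at hx

/-- The homomorphism `A(n) → ℂ[S_n]` that kills all `ε_i`. -/
def toGroup (n : ℕ) : SAlg n →ₐ[ℂ] GAlg n := MonoidAlgebra.lift ℂ _ _ (totalPart n)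

theorem toGroup_gam {n : ℕ} (γ : PBij n) : toGroup n (gam γ) = totalPart n γ := by
  simp [toGroup, gam]

theorem epsP_self {n : ℕ} (i : Fin n) : epsP i i = none := by
  simp [epsP_apply]

theorem swapP_eq_permHom {n : ℕ} (a b : Fin n) : swapP a b = permHom n (Equiv.swap a b) := rfl

/-- The factors `1 - ε_k` and `1 - ε_i` become `1`. -/
theorem toGroup_uFin {n : ℕ} (k : Fin n) : toGroup n (uFin k) = jucys k := by
  simp only [uFin, uTerm, map_sum, map_mul, map_sub, map_one, toGroup_gam,
    totalPart_of_eq_none (epsP_self _), sub_zero, mul_one, swapP_eq_permHom, totalPart_permHom,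
    jucys]

theorem phiP_permHom {m n : ℕ} (h : m ≤ n) (σ : Equiv.Perm (Fin m)) :
    phiP h (permHom m σ) = permHom n (inclPerm h σ) := by
  ext1 x
  rw [phiP_apply, permHom_apply]
  split_ifs with hx
  · obtain ⟨y, rfl⟩ : ∃ y, Fin.castLE h y = x := ⟨⟨x.val, hx⟩, rfl⟩
    rw [inclPerm_apply]
    rfl
  · rw [inclPerm_apply_of_le h σ hx]

theorem phiP_of_eq_none {m n : ℕ} (h : m ≤ n) {γ : PBij m} {x : Fin m} (hx : γ x = none) :
    phiP h γ (Fin.castLE h x) = none := by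
  have hx' : (Fin.castLE h x).val < m := x.2
  rw [phiP_apply, dif_pos hx']
  exact Option.map_eq_none_iff.2 hx

/-! ### The homomorphism from `H̃_m` to `H_m` and its uniqueness -/

/-- The homomorphism from `H̃_m` to the product of the group algebras of `S_n`, `n ≥ m`. -/
def semiToGroups (m : ℕ) : semiHecke m →ₐ[ℂ] ∀ j : ℕ, GAlg (m + j) :=
  (AlgHom.pi fun j => (toGroup (m + j)).comp (Pi.evalAlgHom ℂ (fun j => SAlg (m + j)) j)).comp
    ((limAlg m).val.comp (semiHecke m).val)

theorem semiToGroups_ofSAlg_permHom {m : ℕ} (σ : Equiv.Perm (Fin m)) :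
    semiToGroups m (ofSAlg (gam (permHom m σ))) = heckeToGroups m (permHecke m σ) := by
  funext j
  change toGroup (m + j) (phi (Nat.le_add_right m j) (gam (permHom m σ))) = toGAlg _ _
  rw [phi_gam, toGroup_gam, phiP_permHom, totalPart_permHom, toGAlg_permHecke]

theorem semiToGroups_ofSAlg_of_eq_none {m : ℕ} {γ : PBij m} {x : Fin m} (hx : γ x = none) :
    semiToGroups m (ofSAlg (gam γ)) = 0 := by
  funext j
  change toGroup (m + j) (phi (Nat.le_add_right m j) (gam γ)) = 0
  rw [phi_gam, toGroup_gam, totalPart_of_eq_none (phiP_of_eq_none _ hx)]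

theorem semiToGroups_uGen {m : ℕ} (k : Fin m) :
    semiToGroups m (uGen k) = heckeToGroups m (uHecke k) := by
  funext j
  change toGroup (m + j) (uFin (Fin.castLE (Nat.le_add_right m j) k)) = toGAlg _ _
  rw [toGroup_uFin, toGAlg_uHecke]

/-- The embedding `A(m) → H̃_m` as a homomorphism of algebras. -/
def ofSAlgHom (m : ℕ) : SAlg m →ₐ[ℂ] semiHecke m :=
  (stab m).codRestrict (semiHecke m) fun b => (ofSAlg b).2

/-- Induction over `H̃_m`: a subalgebra that contains the partial bijections and the `u_k` is
everything. -/
theorem mem_of_gen_mem {m : ℕ} (B : Subalgebra ℂ (semiHecke m))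
    (hg : ∀ γ : PBij m, ofSAlg (gam γ) ∈ B) (hu : ∀ k, uGen k ∈ B) (x : semiHecke m) : x ∈ B := by
  -- The generation statement lives in `A_m`, so `B` is pushed forward there before comparison.
  have key : semiHecke m ≤ B.map (semiHecke m).val := by
    refine Algebra.adjoin_le ?_
    rintro _ (⟨b, rfl⟩ | ⟨k, rfl⟩)
    · refine ⟨ofSAlgHom m b, ?_, rfl⟩
      induction b using MonoidAlgebra.induction_linear with
      | zero => rw [map_zero]; exact B.zero_mem
      | add a b ha hb => rw [map_add]; exact B.add_mem ha hb
      | single γ r =>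
        have : (MonoidAlgebra.single γ r : SAlg m) = r • gam γ := by simp [gam]
        rw [this, map_smul]
        exact B.smul_mem (hg γ) r
    · exact ⟨uGen k, hu k, rfl⟩
  obtain ⟨y, hy, hxy⟩ := key x.2
  rwa [← Subtype.ext hxy]

/-- It suffices to check generators: permutations and the `u_k` have the same images as their
counterparts in `H_m`, and other partial bijections go to `0`. -/
theorem semiToGroups_mem_range {m : ℕ} (x : semiHecke m) :
    semiToGroups m x ∈ (heckeToGroups m).range := by
  refine mem_of_gen_mem ((heckeToGroups m).range.comap (semiToGroups m)) (fun γ => ?_)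
    (fun k => ?_) x
  · by_cases h : ∀ x, γ x ≠ none
    · obtain ⟨σ, rfl⟩ := exists_permHom_eq h
      exact ⟨permHecke m σ, (semiToGroups_ofSAlg_permHom σ).symm⟩
    · push Not at h
      obtain ⟨x, hx⟩ := h
      rw [Subalgebra.mem_comap, semiToGroups_ofSAlg_of_eq_none hx]
      exact zero_mem _
  · exact ⟨uHecke k, (semiToGroups_uGen k).symm⟩

/-- The homomorphism `H̃_m → H_m`. -/
def semiToHecke (m : ℕ) : semiHecke m →ₐ[ℂ] Hecke m :=
  ((AlgEquiv.ofInjective _ (heckeToGroups_injective m)).symm : _ →ₐ[ℂ] Hecke m).comp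
    ((semiToGroups m).codRestrict _ semiToGroups_mem_range)

theorem heckeToGroups_semiToHecke {m : ℕ} (x : semiHecke m) :
    heckeToGroups m (semiToHecke m x) = semiToGroups m x :=
  congrArg Subtype.val ((AlgEquiv.ofInjective _ (heckeToGroups_injective m)).apply_symm_apply
    ((semiToGroups m).codRestrict _ semiToGroups_mem_range x))

theorem semiToHecke_ofSAlg_permHom {m : ℕ} (σ : Equiv.Perm (Fin m)) :
    semiToHecke m (ofSAlg (gam (permHom m σ))) = permHecke m σ :=
  heckeToGroups_injective m
    ((heckeToGroups_semiToHecke _).trans (semiToGroups_ofSAlg_permHom σ))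

theorem semiToHecke_sGen {m : ℕ} (k : Fin (m - 1)) : semiToHecke m (sGen k) = sHecke k :=
  (semiToHecke_ofSAlg_permHom (adjSwap k)).trans (permHecke_adjSwap k)

theorem semiToHecke_uGen {m : ℕ} (k : Fin m) : semiToHecke m (uGen k) = uHecke k :=
  heckeToGroups_injective m ((heckeToGroups_semiToHecke _).trans (semiToGroups_uGen k))

theorem semiToHecke_epsGen {m : ℕ} (k : Fin m) : semiToHecke m (epsGen k) = 0 :=
  heckeToGroups_injective m ((heckeToGroups_semiToHecke _).trans
    ((semiToGroups_ofSAlg_of_eq_none (epsP_self k)).trans (map_zero _).symm))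

/-- The range contains `1` and is closed under left multiplication by the generators of `H_m`, all
of which are values of the map. -/
theorem semiToHecke_surjective (m : ℕ) : Function.Surjective (semiToHecke m) := by
  refine fun x => mem_of_mul_mem (Subalgebra.toSubmodule (semiToHecke m).range)
    (one_mem (semiToHecke m).range) ?_ ?_ x
  · rintro k _ ⟨y, rfl⟩
    exact ⟨sGen k * y, by simp [semiToHecke_sGen]⟩
  · rintro k _ ⟨y, rfl⟩
    exact ⟨uGen k * y, by simp [semiToHecke_uGen]⟩

/-- A homomorphism from `H̃_m` is determined by its values on the `s_k`, `u_k` and `ε_k`, if these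
last are `0`. -/
theorem algHom_ext_of_epsGen {m : ℕ} {R : Type*} [Semiring R] [Algebra ℂ R]
    {f g : semiHecke m →ₐ[ℂ] R} (hs : ∀ k, f (sGen k) = g (sGen k))
    (hu : ∀ k, f (uGen k) = g (uGen k)) (hf : ∀ k, f (epsGen k) = 0)
    (hg : ∀ k, g (epsGen k) = 0) : f = g := by
  -- Both maps restrict to monoid homomorphisms on `S_m`, so agreement on adjacent transpositions
  -- suffices.
  have hperm : ∀ σ, f (ofSAlg (gam (permHom m σ))) = g (ofSAlg (gam (permHom m σ))) := by
    let i : Equiv.Perm (Fin m) →* semiHecke m :=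
      (ofSAlgHom m : SAlg m →* semiHecke m).comp ((MonoidAlgebra.of ℂ _).comp (permHom m))
    have : (f : semiHecke m →* R).comp i = (g : semiHecke m →* R).comp i := by
      refine MonoidHom.eq_of_eqOn_denseM (closure_adjSwap m) ?_
      rintro _ ⟨k, rfl⟩
      exact hs k
    exact fun σ => DFunLike.congr_fun this σ
  have hzero : ∀ (f : semiHecke m →ₐ[ℂ] R), (∀ k, f (epsGen k) = 0) → ∀ (γ : PBij m) (x : Fin m),
      γ x = none → f (ofSAlg (gam γ)) = 0 := by
    intro f hf γ x hx
    have e : ofSAlg (gam γ) = ofSAlg (gam γ) * epsGen x := by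
      change ofSAlgHom m (gam γ) = ofSAlgHom m (gam γ) * ofSAlgHom m (gam (epsP x))
      rw [← map_mul, ← gam_mul, mul_epsP_of_eq_none hx]
    rw [e, map_mul, hf, mul_zero]
  refine AlgHom.ext fun x => mem_of_gen_mem (AlgHom.equalizer f g) (fun γ => ?_) hu x
  by_cases h : ∀ x, γ x ≠ none
  · obtain ⟨σ, rfl⟩ := exists_permHom_eq h
    exact hperm σ
  · push Not at h
    obtain ⟨x, hx⟩ := h
    exact (hzero f hf γ x hx).trans (hzero g hg γ x hx).symm

end SemigroupHecke

end

theorem corollary5p20 (m : ℕ) :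
    ∃ f : SemigroupHecke.semiHecke m →ₐ[ℂ] SemigroupHecke.Hecke m,
      (∀ k : Fin (m - 1), f (SemigroupHecke.sGen k) = SemigroupHecke.sHecke k) ∧
      (∀ k : Fin m, f (SemigroupHecke.uGen k) = SemigroupHecke.uHecke k) ∧
      (∀ k : Fin m, f (SemigroupHecke.epsGen k) = 0) ∧
      Function.Surjective f ∧
      ∀ g : SemigroupHecke.semiHecke m →ₐ[ℂ] SemigroupHecke.Hecke m,
        (∀ k : Fin (m - 1), g (SemigroupHecke.sGen k) = SemigroupHecke.sHecke k) →
        (∀ k : Fin m, g (SemigroupHecke.uGen k) = SemigroupHecke.uHecke k) →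
        (∀ k : Fin m, g (SemigroupHecke.epsGen k) = 0) → g = f := by
  open SemigroupHecke in
  exact ⟨semiToHecke m, semiToHecke_sGen, semiToHecke_uGen, semiToHecke_epsGen,
    semiToHecke_surjective m, fun g hs hu he => algHom_ext_of_epsGen
      (fun k => (hs k).trans (semiToHecke_sGen k).symm)
      (fun k => (hu k).trans (semiToHecke_uGen k).symm) he semiToHecke_epsGen⟩
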